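/- Let $M$ be a von Neumann algebra acting on a complex Hilbert space $H$, and let $D\subseteq M$ be a Cartan MASA: $D$ is a maximal abelian self-adjoint subalgebra of $M$, there is a faithful normal conditional expectation of $M$ onto $D$, and the groupoid normalizers of $D$ in $M$, that is, the set $$G=\{v\in M:\ vv^*v=v,\ vDv^*\subseteq D,\ v^*Dv\subseteq D\},$$ span a weak-$*$ dense subspace of $M$. Then $G$ is an inverse monoid under multiplication, with $v^\dagger=v^*$. Let $S=G/R_M$ be its quotient by the Munn congruence $R_M=\{(v,w): vev^\dagger=wew^\dagger \text{ for all idempotents } e\in G\}$, let $\mathcal E(S)$ be the set of idempotents of the inverse monoid $S$, and order $S$ by $s\le t$ if and only if $s=te$ for some $e\in\mathcal E(S)$. Then $S$ is a Cartan inverse monoid, that is: 1. $S$ is fundamental: if $ses^\dagger=tet^\dagger$ for all $e\in\mathcal E(S)$, then $s=t$. 2. $S$ is a complete Boolean inverse monoid: $S$ has a zero; $\mathcal E(S)$ is a complete Boolean algebra; any two elements of $S$ have a meet; and every pairwise orthogonal family in $S$ (in particular any two orthogonal elements) has a join in $S$, where $s,t$ are orthogonal if $s^\dagger t=ts^\dagger=0$.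 3. The space of characters of $\mathcal E(S)$ (bounded lattice homomorphisms $\rho:\mathcal E(S)\to\{0,1\}$, with basis of open sets $\{\rho:\rho(e)=1\}$, $e\in\mathcal E(S)$) is hyperstonean: it is compact, Hausdorff and extremally disconnected, and for every nonzero continuous $f\ge 0$ there is a positive normal Radon measure $\mu$ with $\int f\,d\mu>0$. Here $\mu$ is normal if $\int \sup_i f_i\,d\mu=\sup_i\int f_i\,d\mu$ for every bounded increasing net $(f_i)$ of continuous real functions that has a supremum $\sup_i f_i$ in the ordered set of continuous real functions. -/

import Mathlib

universe u

noncomputable section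

/-! ### Inverse monoids -/

/-- An inverse monoid: a monoid in which every `s` has a unique generalized inverse `s⁻¹`,
that is, a unique element with `s * s⁻¹ * s = s` and `s⁻¹ * s * s⁻¹ = s⁻¹`. -/
class InverseMonoid (S : Type u) extends Monoid S, Inv S where
  mul_inv_mul : ∀ s : S, s * s⁻¹ * s = s
  inv_mul_inv : ∀ s : S, s⁻¹ * s * s⁻¹ = s⁻¹
  eq_inv : ∀ s t : S, s * t * s = s → t * s * t = t → t = s⁻¹

namespace InverseMonoid

/-- Generalized inverses are unique as soon as the idempotents commute. -/
theorem inv_unique_of_comm {S : Type u} [Monoid S]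
    (hc : ∀ e f : S, e * e = e → f * f = f → e * f = f * e)
    {s t t' : S} (h1 : s * t * s = s) (h2 : t * s * t = t)
    (h1' : s * t' * s = s) (h2' : t' * s * t' = t') : t = t' := by
  have a1 : (t * s) * (t * s) = t * s := by rw [← mul_assoc, h2]
  have a2 : (t' * s) * (t' * s) = t' * s := by rw [← mul_assoc, h2']
  have b1 : (s * t) * (s * t) = s * t := by rw [← mul_assoc, h1]
  have b2 : (s * t') * (s * t') = s * t' := by rw [← mul_assoc, h1']
  have e1 : t = t' * s * t := by
    calc t = t * (s * t' * s) * t := by rw [h1', h2]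
      _ = ((t * s) * (t' * s)) * t := by simp only [mul_assoc]
      _ = ((t' * s) * (t * s)) * t := by rw [hc _ _ a1 a2]
      _ = t' * s * (t * s * t) := by simp only [mul_assoc]
      _ = t' * s * t := by rw [h2]
  have e2 : t' = t' * s * t := by
    calc t' = t' * (s * t * s) * t' := by rw [h1, h2']
      _ = t' * ((s * t) * (s * t')) := by simp only [mul_assoc]
      _ = t' * ((s * t') * (s * t)) := by rw [hc _ _ b1 b2]
      _ = (t' * s * t') * s * t := by simp only [mul_assoc]
      _ = t' * s * t := by rw [h2']
  rw [e1, ← e2]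

variable {S : Type u} [InverseMonoid S]

theorem inv_inv' (s : S) : s⁻¹⁻¹ = s :=
  (eq_inv s⁻¹ s (inv_mul_inv s) (mul_inv_mul s)).symm

/-- Idempotents of an inverse monoid commute. -/
theorem idem_comm (e f : S) (he : e * e = e) (hf : f * f = f) : e * f = f * e := by
  have key : ∀ e f : S, e * e = e → f * f = f →
      (e * f)⁻¹ = e * f ∧ (e * f) * (e * f) = e * f := by
    intro e f he hf
    set x := (e * f)⁻¹ with hx
    have p1 : e * f * x * (e * f) = e * f := mul_inv_mul _
    have p2 : x * (e * f) * x = x := inv_mul_inv _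
    have q1 : (e * f) * (f * x * e) * (e * f) = e * f := by
      calc (e * f) * (f * x * e) * (e * f) = e * (f * f) * x * ((e * e) * f) := by
            simp only [mul_assoc]
        _ = e * f := by rw [he, hf, p1]
    have q2 : (f * x * e) * (e * f) * (f * x * e) = f * x * e := by
      calc (f * x * e) * (e * f) * (f * x * e) = f * (x * ((e * e) * (f * f)) * x) * e := by
            simp only [mul_assoc]
        _ = f * x * e := by rw [he, hf, p2]
    have hxe : f * x * e = x := eq_inv _ _ q1 q2
    have hxx : x * x = x := by
      calc x * x = (f * x * e) * (f * x * e) := by rw [hxe]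
        _ = f * (x * (e * f) * x) * e := by simp only [mul_assoc]
        _ = x := by rw [p2, hxe]
    have h3 : x = x⁻¹ := eq_inv x x (by rw [hxx, hxx]) (by rw [hxx, hxx])
    have h4 : x = e * f := by rw [h3, hx, inv_inv']
    exact ⟨h4, by rw [← h4]; exact hxx⟩
  obtain ⟨h1, h2⟩ := key e f he hf
  obtain ⟨-, h3⟩ := key f e hf he
  have : f * e = (e * f)⁻¹ := by
    apply eq_inv
    · calc e * f * (f * e) * (e * f) = e * (f * f) * ((e * e) * f) := by simp only [mul_assoc]
        _ = e * f := by rw [he, hf, h2]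
    · calc f * e * (e * f) * (f * e) = f * (e * e) * ((f * f) * e) := by simp only [mul_assoc]
        _ = f * e := by rw [he, hf, h3]
  rw [this, h1]

theorem inv_mul_idem (s : S) : (s⁻¹ * s) * (s⁻¹ * s) = s⁻¹ * s := by
  rw [← mul_assoc, inv_mul_inv]

theorem mul_inv_idem (s : S) : (s * s⁻¹) * (s * s⁻¹) = s * s⁻¹ := by
  rw [← mul_assoc, mul_inv_mul]

theorem mul_inv_rev' (s t : S) : (s * t)⁻¹ = t⁻¹ * s⁻¹ := by
  have hc := idem_comm (t * t⁻¹) (s⁻¹ * s) (mul_inv_idem t) (inv_mul_idem s)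
  symm
  apply eq_inv
  · calc s * t * (t⁻¹ * s⁻¹) * (s * t) = s * ((t * t⁻¹) * (s⁻¹ * s)) * t := by
          simp only [mul_assoc]
      _ = (s * s⁻¹ * s) * (t * t⁻¹ * t) := by rw [hc]; simp only [mul_assoc]
      _ = s * t := by rw [mul_inv_mul, mul_inv_mul]
  · calc t⁻¹ * s⁻¹ * (s * t) * (t⁻¹ * s⁻¹) = t⁻¹ * ((s⁻¹ * s) * (t * t⁻¹)) * s⁻¹ := by
          simp only [mul_assoc]
      _ = (t⁻¹ * t * t⁻¹) * (s⁻¹ * s * s⁻¹) := by rw [← hc]; simp only [mul_assoc]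
      _ = t⁻¹ * s⁻¹ := by rw [inv_mul_inv, inv_mul_inv]

theorem conj_idem (s e : S) (he : e * e = e) : (s * e * s⁻¹) * (s * e * s⁻¹) = s * e * s⁻¹ := by
  calc (s * e * s⁻¹) * (s * e * s⁻¹) = s * (e * (s⁻¹ * s)) * e * s⁻¹ := by
        simp only [mul_assoc]
    _ = (s * s⁻¹ * s) * (e * e) * s⁻¹ := by
        rw [idem_comm e _ he (inv_mul_idem s)]; simp only [mul_assoc]
    _ = s * e * s⁻¹ := by rw [he, mul_inv_mul]

/-- The natural partial order: `s ≤ t` when `s = t * e` for some idempotent `e`. -/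
instance naturalOrder : PartialOrder S where
  le s t := ∃ e : S, e * e = e ∧ s = t * e
  le_refl s := ⟨s⁻¹ * s, inv_mul_idem s, by rw [← mul_assoc, mul_inv_mul]⟩
  le_trans := by
    rintro s t r ⟨e, he, rfl⟩ ⟨f, hf, rfl⟩
    refine ⟨f * e, ?_, mul_assoc _ _ _⟩
    calc (f * e) * (f * e) = f * (e * f) * e := by simp only [mul_assoc]
      _ = (f * f) * (e * e) := by rw [idem_comm e f he hf]; simp only [mul_assoc]
      _ = f * e := by rw [he, hf]
  le_antisymm := by
    rintro s t ⟨e, he, hs⟩ ⟨f, hf, ht⟩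
    have h1 : s * e = s := by rw [hs, mul_assoc, he]
    calc s = t * e := hs
      _ = s * (f * e) := by rw [ht, mul_assoc]
      _ = s * e * f := by rw [idem_comm f e hf he, mul_assoc]
      _ = t := by rw [h1, ← ht]

variable (S) in
/-- The set of idempotents of `S`, with the order inherited from the natural partial order. -/
abbrev Idem : Type u := {e : S // e * e = e}

variable (S) in
/-- The Munn congruence: `s` and `t` are related when `s e s⁻¹ = t e t⁻¹` for every
idempotent `e`. -/
def munnCon : Con S where
  r s t := ∀ e : S, e * e = e → s * e * s⁻¹ = t * e * t⁻¹
  iseqv :=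
    { refl := fun _ _ _ => rfl
      symm := fun h e he => (h e he).symm
      trans := fun h h' e he => (h e he).trans (h' e he) }
  mul' := by
    intro w x y z h h' e he
    calc w * y * e * (w * y)⁻¹ = w * (y * e * y⁻¹) * w⁻¹ := by
          rw [mul_inv_rev']; simp only [mul_assoc]
      _ = x * (z * e * z⁻¹) * x⁻¹ := by rw [h' e he, h _ (conj_idem z e he)]
      _ = x * z * e * (x * z)⁻¹ := by rw [mul_inv_rev']; simp only [mul_assoc]

/-- Every idempotent of the quotient by the Munn congruence is the class of an idempotent. -/
theorem munnCon_idem_lift (a : (munnCon S).Quotient) (ha : a * a = a) :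
    ∃ e : S, e * e = e ∧ (e : (munnCon S).Quotient) = a := by
  induction a using Con.induction_on with
  | H x =>
    refine ⟨x * (x * x)⁻¹ * x, ?_, ?_⟩
    · calc x * (x * x)⁻¹ * x * (x * (x * x)⁻¹ * x)
          = x * ((x * x)⁻¹ * (x * x) * (x * x)⁻¹) * x := by simp only [mul_assoc]
        _ = x * (x * x)⁻¹ * x := by rw [inv_mul_inv]
    · have := congrArg (fun y : S => (y : (munnCon S).Quotient)) (mul_inv_mul (x * x))
      simp only [Con.coe_mul] at this ⊢
      rwa [ha] at this

theorem munnCon_idem_comm (a b : (munnCon S).Quotient) (ha : a * a = a) (hb : b * b = b) :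
    a * b = b * a := by
  obtain ⟨e, he, rfl⟩ := munnCon_idem_lift a ha
  obtain ⟨f, hf, rfl⟩ := munnCon_idem_lift b hb
  rw [← Con.coe_mul, ← Con.coe_mul, idem_comm e f he hf]

theorem munnCon_inv {s t : S} (h : munnCon S s t) : munnCon S s⁻¹ t⁻¹ := by
  have hst : (s : (munnCon S).Quotient) = t := (Con.eq _).2 h
  refine (Con.eq _).1 (inv_unique_of_comm munnCon_idem_comm
    (s := (s : (munnCon S).Quotient)) ?_ ?_ ?_ ?_)
  · rw [← Con.coe_mul, ← Con.coe_mul, mul_inv_mul]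
  · rw [← Con.coe_mul, ← Con.coe_mul, inv_mul_inv]
  · rw [hst, ← Con.coe_mul, ← Con.coe_mul, mul_inv_mul]
  · rw [hst, ← Con.coe_mul, ← Con.coe_mul, inv_mul_inv]

variable (S) in
/-- The quotient of an inverse monoid by its Munn congruence. -/
def MunnQuotient : Type u := (munnCon S).Quotient

/-- The quotient by the Munn congruence is an inverse monoid; the operations are those induced
from representatives. -/
instance munnQuotientInverseMonoid : InverseMonoid (MunnQuotient S) where
  toMonoid := inferInstanceAs (Monoid (munnCon S).Quotient)
  inv := Quotient.map' (fun s : S => s⁻¹) fun _ _ h => munnCon_inv h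
  mul_inv_mul a := Con.induction_on a fun x => by
    exact congrArg (fun y : S => (y : (munnCon S).Quotient)) (mul_inv_mul x)
  inv_mul_inv a := Con.induction_on a fun x => by
    exact congrArg (fun y : S => (y : (munnCon S).Quotient)) (inv_mul_inv x)
  eq_inv a t := Con.induction_on a fun x h1 h2 => by
    refine inv_unique_of_comm munnCon_idem_comm h1 h2
      (t' := ((x⁻¹ : S) : (munnCon S).Quotient)) ?_ ?_
    · exact congrArg (fun y : S => (y : (munnCon S).Quotient)) (mul_inv_mul x)
    · exact congrArg (fun y : S => (y : (munnCon S).Quotient)) (inv_mul_inv x)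

end InverseMonoid

/-! ### Boolean algebras and hyperstonean spaces -/

/-- The partially ordered set `L` is a Boolean algebra. -/
def IsBooleanAlgebra (L : Type u) [PartialOrder L] : Prop :=
  ∃ (B : Type u) (_ : BooleanAlgebra B), Nonempty (L ≃o B)

/-- A character of `L`: a homomorphism of bounded lattices from `L` to the two element lattice.
The lattice operations of `L` are expressed through its order. -/
@[ext]
structure LatticeCharacter (L : Type u) [PartialOrder L] where
  toFun : L → Bool
  map_inf : ∀ a b c : L, IsGLB {a, b} c → toFun c = (toFun a && toFun b)
  map_sup : ∀ a b c : L, IsLUB {a, b} c → toFun c = (toFun a || toFun b)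
  map_top : ∀ a : L, IsTop a → toFun a = true
  map_bot : ∀ a : L, IsBot a → toFun a = false

/-- The topology of the character space, with basis the sets `{ρ | ρ e = 1}`, for `e` in `L`. -/
instance (L : Type u) [PartialOrder L] : TopologicalSpace (LatticeCharacter L) :=
  TopologicalSpace.generateFrom (Set.range fun e : L => {ρ | ρ.toFun e = true})

/-- A positive Radon measure on a compact Hausdorff space is normal if it preserves the suprema
(in the ordered set of continuous real functions) of bounded upward directed families. -/
structure IsNormalMeasure {X : Type u} [TopologicalSpace X] [MeasurableSpace X] [BorelSpace X]
    (μ : MeasureTheory.Measure X) : Prop where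
  finite : MeasureTheory.IsFiniteMeasure μ
  regular : μ.Regular
  isLUB_integral : ∀ (F : Set C(X, ℝ)) (f : C(X, ℝ)), F.Nonempty → DirectedOn (· ≤ ·) F →
    IsLUB F f → IsLUB ((fun g : C(X, ℝ) => ∫ x, g x ∂μ) '' F) (∫ x, f x ∂μ)

/-- A hyperstonean space: an extremally disconnected compact Hausdorff space with sufficiently
many positive normal measures. -/
structure IsHyperstonean (X : Type u) [TopologicalSpace X] : Prop where
  compact : CompactSpace X
  t2 : T2Space X
  extremallyDisconnected : ExtremallyDisconnected X
  exists_normal : letI : MeasurableSpace X := borel X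
    haveI : BorelSpace X := ⟨rfl⟩
    ∀ f : C(X, ℝ), 0 ≤ f → f ≠ 0 →
      ∃ μ : MeasureTheory.Measure X, IsNormalMeasure μ ∧ 0 < ∫ x, f x ∂μ

/-! ### Cartan inverse monoids -/

namespace InverseMonoid

/-- `z` is a zero element. -/
def IsZeroElem {S : Type u} [InverseMonoid S] (z : S) : Prop :=
  ∀ s : S, s * z = z ∧ z * s = z

/-- `s` and `t` are orthogonal: `s⁻¹ * t = 0 = t * s⁻¹`. -/
def Orthogonal {S : Type u} [InverseMonoid S] (s t : S) : Prop :=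
  IsZeroElem (s⁻¹ * t) ∧ IsZeroElem (t * s⁻¹)

/-- An inverse monoid is fundamental if its elements are determined by their conjugation action
on idempotents. -/
def IsFundamental (S : Type u) [InverseMonoid S] : Prop :=
  ∀ s t : S, (∀ e : S, e * e = e → s * e * s⁻¹ = t * e * t⁻¹) → s = t

/-- Boolean inverse monoids; all order notions refer to the natural partial order. -/
structure IsBoolean (S : Type u) [InverseMonoid S] : Prop where
  exists_zero : ∃ z : S, IsZeroElem z
  idem_boolean : IsBooleanAlgebra (Idem S)
  exists_meet : ∀ s t : S, ∃ m : S, IsGLB {s, t} m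
  exists_join : ∀ s t : S, Orthogonal s t → ∃ j : S, IsLUB {s, t} j

/-- Complete Boolean inverse monoids: the idempotents form a complete Boolean algebra and every
pairwise orthogonal family has a join. -/
structure IsCompleteBoolean (S : Type u) [InverseMonoid S] : Prop extends IsBoolean S where
  idem_complete : ∀ A : Set (Idem S), ∃ e : Idem S, IsLUB A e
  exists_sSup : ∀ A : Set S, A.Pairwise Orthogonal → ∃ j : S, IsLUB A j

/-- Cartan inverse monoids. -/
structure IsCartan (S : Type u) [InverseMonoid S] : Prop where
  fundamental : IsFundamental S
  completeBoolean : IsCompleteBoolean S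
  hyperstonean : IsHyperstonean (LatticeCharacter (Idem S))

end InverseMonoid

/-! ### Cartan pairs of von Neumann algebras -/

section CartanPair

variable {H : Type u} [NormedAddCommGroup H] [InnerProductSpace ℂ H] [CompleteSpace H]

variable (H) in
/-- The weak-* (ultraweak) topology on the bounded operators, that is, the coarsest topology for
which the functionals `T ↦ ∑ ⟪ξ n, T (η n)⟫`, with `ξ` and `η` square summable, are continuous.
The weak-* topology of a von Neumann algebra acting on `H` is the subspace topology. -/
@[reducible]
def ultraweak : TopologicalSpace (H →L[ℂ] H) :=
  ⨅ (ξ : lp (fun _ : ℕ => H) 2) (η : lp (fun _ : ℕ => H) 2),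
    TopologicalSpace.induced (fun T : H →L[ℂ] H => ∑' n, inner ℂ (ξ n) (T (η n))) inferInstance

/-- `D` is a maximal abelian self-adjoint subalgebra of `M`. -/
def IsMASA (M : VonNeumannAlgebra H) (D : StarSubalgebra ℂ (H →L[ℂ] H)) : Prop :=
  Maximal (fun A : StarSubalgebra ℂ (H →L[ℂ] H) =>
    A ≤ M.toStarSubalgebra ∧ ∀ x ∈ A, ∀ y ∈ A, x * y = y * x) D

/-- The groupoid normalizers of `D` in `M`: the partial isometries `v` in `M` with
`v D v* ⊆ D` and `v* D v ⊆ D`. -/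
def groupoidNormalizers (M : VonNeumannAlgebra H) (D : StarSubalgebra ℂ (H →L[ℂ] H)) :
    Set (H →L[ℂ] H) :=
  {v | v ∈ M ∧ v * star v * v = v ∧ ∀ d ∈ D, v * d * star v ∈ D ∧ star v * d * v ∈ D}

/-- `E` is a faithful normal conditional expectation of `M` onto `D`. -/
structure IsFaithfulNormalCondExp (M : VonNeumannAlgebra H) (D : StarSubalgebra ℂ (H →L[ℂ] H))
    (E : M.toStarSubalgebra →ₗ[ℂ] D) : Prop where
  apply_mem : ∀ x : M.toStarSubalgebra, (x : H →L[ℂ] H) ∈ D → (E x : H →L[ℂ] H) = x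
  positive : ∀ x : M.toStarSubalgebra,
    (x : H →L[ℂ] H).IsPositive → (E x : H →L[ℂ] H).IsPositive
  bimodule : ∀ a x b : M.toStarSubalgebra, (a : H →L[ℂ] H) ∈ D → (b : H →L[ℂ] H) ∈ D →
    (E (a * x * b) : H →L[ℂ] H) = a * E x * b
  faithful : ∀ x : M.toStarSubalgebra, E (star x * x) = 0 → x = 0
  normal : @Continuous M.toStarSubalgebra D ((ultraweak H).induced Subtype.val)
    ((ultraweak H).induced Subtype.val) E

variable (H) in
/-- A Cartan pair: a von Neumann algebra `M` acting on `H` with a Cartan MASA `D`. -/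
structure CartanPair where
  M : VonNeumannAlgebra H
  D : StarSubalgebra ℂ (H →L[ℂ] H)
  isMASA : IsMASA M D
  exists_condExp : ∃ E : M.toStarSubalgebra →ₗ[ℂ] D, IsFaithfulNormalCondExp M D E
  dense_normalizers : (M : Set (H →L[ℂ] H)) ⊆
    @closure _ (ultraweak H) (Submodule.span ℂ (groupoidNormalizers M D) : Set (H →L[ℂ] H))

namespace CartanPair

variable (P : CartanPair H)

theorem D_le : ∀ x ∈ P.D, x ∈ P.M := fun _ hx => P.isMASA.prop.1 hx

theorem D_comm : ∀ x ∈ P.D, ∀ y ∈ P.D, x * y = y * x := P.isMASA.prop.2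

/-- The inverse monoid of groupoid normalizers. -/
def G : Type u := groupoidNormalizers P.M P.D

theorem star_mul_self_mem {v : H →L[ℂ] H} (hv : v ∈ groupoidNormalizers P.M P.D) :
    star v * v ∈ P.D ∧ v * star v ∈ P.D := by
  have := hv.2.2 1 (one_mem _)
  simpa [and_comm] using this

theorem one_mem_gn : (1 : H →L[ℂ] H) ∈ groupoidNormalizers P.M P.D :=
  ⟨one_mem _, by simp, fun d hd => by simpa using hd⟩

theorem star_partial {v : H →L[ℂ] H} (hv : v * star v * v = v) :
    star v * v * star v = star v := by
  have := congrArg star hv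
  simpa [mul_assoc] using this

theorem star_mem_gn {v : H →L[ℂ] H} (hv : v ∈ groupoidNormalizers P.M P.D) :
    star v ∈ groupoidNormalizers P.M P.D :=
  ⟨star_mem hv.1, by rw [star_star]; exact star_partial hv.2.1,
    fun d hd => by rw [star_star]; exact (hv.2.2 d hd).symm⟩

theorem mul_mem_gn {v w : H →L[ℂ] H} (hv : v ∈ groupoidNormalizers P.M P.D)
    (hw : w ∈ groupoidNormalizers P.M P.D) : v * w ∈ groupoidNormalizers P.M P.D := by
  refine ⟨mul_mem hv.1 hw.1, ?_, fun d hd => ⟨?_, ?_⟩⟩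
  · have hc := P.D_comm _ (P.star_mul_self_mem hv).1 _ (P.star_mul_self_mem hw).2
    calc v * w * star (v * w) * (v * w) = v * ((w * star w) * (star v * v)) * w := by
          rw [star_mul]; simp only [mul_assoc]
      _ = (v * star v * v) * (w * star w * w) := by rw [← hc]; simp only [mul_assoc]
      _ = v * w := by rw [hv.2.1, hw.2.1]
  · have := (hv.2.2 _ (hw.2.2 d hd).1).1
    simpa only [star_mul, mul_assoc] using this
  · have := (hw.2.2 _ (hv.2.2 d hd).2).2
    simpa only [star_mul, mul_assoc] using this

/-- Idempotent groupoid normalizers lie in `D`. -/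
theorem idem_mem_D {e : H →L[ℂ] H} (he : e ∈ groupoidNormalizers P.M P.D) (hee : e * e = e) :
    e ∈ P.D := by
  have hc := P.D_comm _ (P.star_mul_self_mem he).1 _ (P.star_mul_self_mem he).2
  have hss : star e * star e = star e := by rw [← star_mul, hee]
  have h1 : (star e * e) * (e * star e) = star e := by
    calc (star e * e) * (e * star e) = star e * (e * e) * star e := by simp only [mul_assoc]
      _ = star e := by rw [hee, star_partial he.2.1]
  have h2 : (e * star e) * (star e * e) = e := by
    calc (e * star e) * (star e * e) = e * (star e * star e) * e := by simp only [mul_assoc]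
      _ = e := by rw [hss, he.2.1]
  have h3 : star e = e := by rw [← h1, hc, h2]
  have := (P.star_mul_self_mem he).1
  rwa [h3, hee] at this

instance : Monoid P.G where
  mul v w := ⟨v.1 * w.1, P.mul_mem_gn v.2 w.2⟩
  one := ⟨1, P.one_mem_gn⟩
  mul_assoc u v w := Subtype.ext (mul_assoc u.1 v.1 w.1)
  one_mul v := Subtype.ext (one_mul v.1)
  mul_one v := Subtype.ext (mul_one v.1)

theorem G_idem_comm (e f : P.G) (he : e * e = e) (hf : f * f = f) : e * f = f * e :=
  Subtype.ext (P.D_comm _ (P.idem_mem_D e.2 (congrArg Subtype.val he))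
    _ (P.idem_mem_D f.2 (congrArg Subtype.val hf)))

/-- The groupoid normalizers form an inverse monoid under multiplication of operators, with the
adjoint as inverse. -/
instance : InverseMonoid P.G where
  inv v := ⟨star v.1, P.star_mem_gn v.2⟩
  mul_inv_mul v := Subtype.ext v.2.2.1
  inv_mul_inv v := Subtype.ext (star_partial v.2.2.1)
  eq_inv v _ h1 h2 := InverseMonoid.inv_unique_of_comm P.G_idem_comm h1 h2
    (Subtype.ext v.2.2.1) (Subtype.ext (star_partial v.2.2.1))

/-- The quotient of the groupoid normalizers by the Munn congruence. -/
abbrev S : Type u := InverseMonoid.MunnQuotient P.G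

end CartanPair

end CartanPair

end

/-! A MASA `D` equals its relative commutant in `M`, and `M` is its own bicommutant, so `D` is cut
out of `B(H)` by commutation relations (`mem_D_of_commute`). Hence `D` is closed under weak limits
and contains the range projection of each of its subsets. Everything else rests on these two closure
properties.

The Munn congruence separates idempotents, so the idempotents of `S` are exactly the projections of
`D`, a complete Boolean algebra. Since conjugates of idempotents are idempotents, `S` is
fundamental. For joins, an orthogonal family of normalizers is summed: the finite partial sums are
partial isometries, hence contractions, and a weak cluster point is again a normalizer
(`exists_glue`). For meets, `v` is cut down to the largest projection below which `v` and `w` act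
alike; that this supremum inherits the property is `conj_range_projection_eq`.

Characters of the lattice of projections are points of the Gelfand spectrum of `D` (`specHomeo`).
Range projections make closures of open sets clopen there. The vector functionals of `H` give
positive Radon measures by Riesz representation; they are normal because a bounded increasing family
in `D` has a weak cluster point in `D` dominating the family, so that its supremum is approached in
every quadratic form (`isLUB_quad`). -/

noncomputable section

open Filter Topology

/-! ### Weak operator limits, range projections and partial isometries. -/

section Operators

variable {H : Type u} [NormedAddCommGroup H] [InnerProductSpace ℂ H]

/-- Weak convergence of a family of operators. -/
def TendstoWeakly {ι : Type*} (U : Filter ι) (T : ι → H →L[ℂ] H) (L : H →L[ℂ] H) : Prop :=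
  ∀ x y : H, Tendsto (fun i => inner ℂ (T i x) y) U (𝓝 (inner ℂ (L x) y))

namespace TendstoWeakly

variable {ι : Type*} {U : Filter ι} {T : ι → H →L[ℂ] H} {L L' : H →L[ℂ] H}

theorem unique [U.NeBot] (h : TendstoWeakly U T L) (h' : TendstoWeakly U T L') : L = L' := by
  ext x
  exact ext_inner_right ℂ fun y => tendsto_nhds_unique (h x y) (h' x y)

theorem of_eventually_eq (h : ∀ᶠ i in U, T i = L) : TendstoWeakly U T L := fun x y =>
  tendsto_const_nhds.congr' (h.mono fun i hi => by simp only [hi])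

theorem mul_right (h : TendstoWeakly U T L) (a : H →L[ℂ] H) :
    TendstoWeakly U (fun i => T i * a) (L * a) := fun x y => h (a x) y

theorem congr {T' : ι → H →L[ℂ] H} (h : TendstoWeakly U T L) (h' : ∀ᶠ i in U, T i = T' i) :
    TendstoWeakly U T' L := fun x y =>
  (h x y).congr' (h'.mono fun i hi => by simp only [hi])

variable [CompleteSpace H]

theorem mul_left (h : TendstoWeakly U T L) (a : H →L[ℂ] H) :
    TendstoWeakly U (fun i => a * T i) (a * L) := fun x y => by
  have h1 := h x (ContinuousLinearMap.adjoint a y)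
  simp only [ContinuousLinearMap.adjoint_inner_right] at h1
  exact h1

theorem star (h : TendstoWeakly U T L) :
    TendstoWeakly U (fun i => star (T i)) (star L) := fun x y => by
  have h1 := (Complex.continuous_conj.tendsto _).comp (h y x)
  simpa only [Function.comp_def, inner_conj_symm, ContinuousLinearMap.star_eq_adjoint,
    ContinuousLinearMap.adjoint_inner_left] using h1

theorem commute [U.NeBot] (h : TendstoWeakly U T L) {a : H →L[ℂ] H}
    (ha : ∀ᶠ i in U, a * T i = T i * a) : a * L = L * a :=
  (h.mul_left a).unique ((h.mul_right a).congr (ha.mono fun _ hi => hi.symm))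

end TendstoWeakly

variable [CompleteSpace H]

/-- The projection onto the closed span of the ranges of a family of operators. -/
theorem exists_range_projection (A : Set (H →L[ℂ] H)) :
    ∃ q : H →L[ℂ] H, IsStarProjection q ∧ (∀ a ∈ A, q * a = a) ∧
      ∀ X : H →L[ℂ] H, (∀ a ∈ A, X * a = 0) → X * q = 0 := by
  set K : Submodule ℂ H := (Submodule.span ℂ (⋃ a ∈ A, Set.range a)).topologicalClosure with hK
  have : CompleteSpace K := (Submodule.isClosed_topologicalClosure _).completeSpace_coe
  refine ⟨K.starProjection, isStarProjection_starProjection, fun a ha => ?_, fun X hX => ?_⟩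
  · ext x
    refine Submodule.starProjection_eq_self_iff.2 (Submodule.le_topologicalClosure _ ?_)
    exact Submodule.subset_span (Set.mem_biUnion ha ⟨x, rfl⟩)
  · have hle : K ≤ LinearMap.ker (X : H →ₗ[ℂ] H) := by
      refine Submodule.topologicalClosure_minimal _ (Submodule.span_le.2 ?_) X.isClosed_ker
      rintro _ hy
      obtain ⟨a, ha, x, rfl⟩ := Set.mem_iUnion₂.1 hy
      exact congrArg (fun T : H →L[ℂ] H => T x) (hX a ha)
    ext x
    exact hle (K.starProjection_apply_mem x)

/-- Bounded families of operators converge weakly along ultrafilters. -/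
theorem exists_weak_limit {ι : Type*} (U : Ultrafilter ι) (T : ι → H →L[ℂ] H) (C : ℝ)
    (hC : ∀ᶠ i in U, ‖T i‖ ≤ C) :
    ∃ L : H →L[ℂ] H, TendstoWeakly U T L := by
  have hb : ∀ x y : H, ∀ᶠ i in U, ‖(inner ℂ (T i x) y : ℂ)‖ ≤ C * ‖x‖ * ‖y‖ := fun x y => by
    filter_upwards [hC] with i hi
    refine (norm_inner_le_norm _ _).trans ?_
    gcongr
    exact (T i).le_of_opNorm_le hi x
  have hlim : ∀ x y : H, ∃ l : ℂ, Tendsto (fun i => (inner ℂ (T i x) y : ℂ)) U (𝓝 l) := by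
    intro x y
    have hmem : ∀ᶠ i in U, (inner ℂ (T i x) y : ℂ) ∈ Metric.closedBall (0 : ℂ) (C * ‖x‖ * ‖y‖) := by
      filter_upwards [hb x y] with i hi
      simpa using hi
    obtain ⟨l, -, hl⟩ := (isCompact_closedBall (0 : ℂ) (C * ‖x‖ * ‖y‖)).ultrafilter_le_nhds'
      (U.map fun i => (inner ℂ (T i x) y : ℂ)) hmem
    exact ⟨l, hl⟩
  choose l hl using hlim
  -- The pointwise limits of the sesquilinear forms of `T i` are again sesquilinear and bounded by
  -- `C`, so they come from an operator.
  let B : H →L⋆[ℂ] H →L[ℂ] ℂ := LinearMap.mkContinuous₂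
    (LinearMap.mk₂'ₛₗ (starRingEnd ℂ) (RingHom.id ℂ) l
      (fun x x' y => tendsto_nhds_unique (hl (x + x') y) (by
        simpa only [map_add, inner_add_left] using (hl x y).add (hl x' y)))
      (fun c x y => tendsto_nhds_unique (hl (c • x) y) (by
        simpa only [map_smul, inner_smul_left, smul_eq_mul] using (hl x y).const_mul (starRingEnd ℂ c)))
      (fun x y y' => tendsto_nhds_unique (hl x (y + y')) (by
        simpa only [inner_add_right] using (hl x y).add (hl x y')))
      (fun c x y => tendsto_nhds_unique (hl x (c • y)) (by
        simpa only [inner_smul_right, RingHom.id_apply, smul_eq_mul] using (hl x y).const_mul c)))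
    C (fun x y => le_of_tendsto (hl x y).norm (hb x y))
  refine ⟨InnerProductSpace.continuousLinearMapOfBilin B, fun x y => ?_⟩
  rw [InnerProductSpace.continuousLinearMapOfBilin_apply]
  exact hl x y

/-- A partial isometry is a contraction. -/
theorem norm_le_one_of_mul_star_mul {v : H →L[ℂ] H} (hv : v * star v * v = v) : ‖v‖ ≤ 1 := by
  have hp : star (star v * v) * (star v * v) = star v * v := by
    rw [star_mul, star_star, mul_assoc, ← mul_assoc v, hv]
  -- As `star v * v` is a projection, applying the C⋆-identity twice gives `‖v‖ ^ 2 = ‖v‖ ^ 4`.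
  have h := CStarRing.norm_star_mul_self (x := star v * v)
  rw [hp, CStarRing.norm_star_mul_self] at h
  by_contra! hlt
  nlinarith [mul_pos (sub_pos.2 hlt) (sub_pos.2 hlt)]

end Operators

/-! ### The MASA as a commutant: weak limits and suprema of projections. -/

namespace CartanPair

variable {H : Type u} [NormedAddCommGroup H] [InnerProductSpace ℂ H] [CompleteSpace H]
  (P : CartanPair H)

theorem mem_M_of_commute {x : H →L[ℂ] H}
    (hx : ∀ y : H →L[ℂ] H, (∀ z ∈ P.M, z * y = y * z) → y * x = x * y) : x ∈ P.M := by
  rw [← P.M.commutant_commutant, VonNeumannAlgebra.mem_commutant_iff]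
  exact fun y hy => hx y (VonNeumannAlgebra.mem_commutant_iff.1 hy)

/-- Adjoining `x` to `D` produces a commutative star subalgebra of `M`, which maximality puts inside
`D`. Self-adjointness keeps the generating set closed under the adjoint. -/
theorem mem_D_of_isSelfAdjoint {x : H →L[ℂ] H} (hs : star x = x) (hM : x ∈ P.M)
    (hx : ∀ d ∈ P.D, d * x = x * d) : x ∈ P.D := by
  have hcomm : ∀ a ∈ (P.D : Set (H →L[ℂ] H)) ∪ {x}, ∀ b ∈ (P.D : Set (H →L[ℂ] H)) ∪ {x},
      a * b = b * a := by
    rintro a (ha | rfl) b (hb | rfl)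
    exacts [P.D_comm a ha b hb, hx a ha, (hx b hb).symm, rfl]
  have hstar : ∀ b ∈ (P.D : Set (H →L[ℂ] H)) ∪ {x},
      star b ∈ (P.D : Set (H →L[ℂ] H)) ∪ {x} := by
    rintro b (hb | rfl)
    exacts [Or.inl (star_mem hb), Or.inr hs]
  have hc := StarAlgebra.isMulCommutative_adjoin ℂ hcomm
    fun a ha b hb => hcomm a ha _ (hstar b hb)
  refine P.isMASA.le_of_ge
    (y := StarAlgebra.adjoin ℂ ((P.D : Set (H →L[ℂ] H)) ∪ {x})) ⟨?_, fun a ha b hb => ?_⟩ ?_ ?_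
  · refine StarAlgebra.adjoin_le ?_
    rintro a (ha | rfl)
    exacts [P.D_le a ha, hM]
  · exact congrArg Subtype.val (hc.is_comm.comm (⟨a, ha⟩ : StarAlgebra.adjoin ℂ _) ⟨b, hb⟩)
  · exact fun a ha => StarAlgebra.subset_adjoin ℂ _ (Or.inl ha)
  · exact StarAlgebra.subset_adjoin ℂ _ (Or.inr rfl)

/-- A maximal abelian self-adjoint subalgebra is its own relative commutant. -/
theorem mem_D {x : H →L[ℂ] H} (hM : x ∈ P.M) (hx : ∀ d ∈ P.D, d * x = x * d) : x ∈ P.D := by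
  have hx' : ∀ d ∈ P.D, d * star x = star x * d := fun d hd => by
    simpa using (congrArg star (hx _ (star_mem hd))).symm
  have hsm : ∀ (c : ℂ) {y : H →L[ℂ] H}, y ∈ P.M → c • y ∈ P.M := fun c y hy =>
    P.M.toStarSubalgebra.smul_mem hy c
  -- The real part of `x`, and then the imaginary part, both self-adjoint elements of `M` commuting
  -- with `D`.
  have h1 : (2⁻¹ : ℂ) • (x + star x) ∈ P.D := by
    refine P.mem_D_of_isSelfAdjoint ?_ (hsm _ (add_mem hM (star_mem hM))) fun d hd => ?_
    · simp [add_comm]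
    · simp only [mul_smul_comm, smul_mul_assoc, mul_add, add_mul, hx d hd, hx' d hd]
  have h2 : (2⁻¹ * Complex.I : ℂ) • (star x - x) ∈ P.D := by
    refine P.mem_D_of_isSelfAdjoint ?_ (hsm _ (sub_mem (star_mem hM) hM)) fun d hd => ?_
    · simp [← smul_neg]
    · simp only [mul_smul_comm, smul_mul_assoc, mul_sub, sub_mul, hx d hd, hx' d hd]
  have h3 := add_mem h1 (P.D.smul_mem h2 Complex.I)
  convert! h3 using 1
  rw [smul_smul, show Complex.I * (2⁻¹ * Complex.I) = -2⁻¹ by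
    rw [mul_left_comm, Complex.I_mul_I]; ring]
  module

/-- A maximal abelian self-adjoint subalgebra of a von Neumann algebra is its own double
commutant. -/
theorem mem_D_of_commute {x : H →L[ℂ] H}
    (hx : ∀ y : H →L[ℂ] H, (∀ z ∈ P.D, z * y = y * z) → y * x = x * y) : x ∈ P.D :=
  P.mem_D (P.mem_M_of_commute fun y hy => hx y fun z hz => hy z (P.D_le z hz))
    fun d hd => hx d fun z hz => P.D_comm z hz d hd

theorem mem_D_of_tendstoWeakly {ι : Type*} {U : Filter ι} [U.NeBot] {T : ι → H →L[ℂ] H}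
    {L : H →L[ℂ] H} (h : TendstoWeakly U T L) (hT : ∀ i, T i ∈ P.D) : L ∈ P.D :=
  P.mem_D_of_commute fun _ hy => h.commute (Eventually.of_forall fun i => (hy _ (hT i)).symm)

theorem mem_M_of_tendstoWeakly {ι : Type*} {U : Filter ι} [U.NeBot] {T : ι → H →L[ℂ] H}
    {L : H →L[ℂ] H} (h : TendstoWeakly U T L) (hT : ∀ i, T i ∈ P.M) : L ∈ P.M :=
  P.mem_M_of_commute fun _ hy => h.commute (Eventually.of_forall fun i => (hy _ (hT i)).symm)

/-- Norm closedness makes `D` a commutative C⋆-algebra, to which Gelfand duality applies. -/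
instance isClosed_D : IsClosed (P.D : Set (H →L[ℂ] H)) := by
  have : (P.D : Set (H →L[ℂ] H)) =
      ⋂ y ∈ {y : H →L[ℂ] H | ∀ z ∈ P.D, z * y = y * z}, {x | y * x = x * y} := by
    ext x
    simp only [Set.mem_iInter, Set.mem_ofPred_eq, SetLike.mem_coe]
    exact ⟨fun hx y hy => (hy x hx).symm, P.mem_D_of_commute⟩
  rw [this]
  exact isClosed_biInter fun y _ =>
    isClosed_eq (continuous_const.mul continuous_id) (continuous_id.mul continuous_const)

instance : CommCStarAlgebra P.D :=
  { StarSubalgebra.cstarAlgebra P.D with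
    mul_comm := fun a b => Subtype.ext (P.D_comm a a.2 b b.2) }

/-- The projection onto the closed span of the ranges of a family of elements of `D` is in `D`. -/
theorem exists_range_projection_mem (A : Set (H →L[ℂ] H)) (hA : ∀ a ∈ A, a ∈ P.D) :
    ∃ q ∈ P.D, IsStarProjection q ∧ (∀ a ∈ A, q * a = a) ∧
      ∀ X : H →L[ℂ] H, (∀ a ∈ A, X * a = 0) → X * q = 0 := by
  obtain ⟨q, hq, h1, h2⟩ := exists_range_projection A
  refine ⟨q, P.mem_D_of_commute fun y hy => ?_, hq, h1, h2⟩
  -- The commutant of `D` leaves the range of `q` invariant; being self-adjoint, it commutes with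
  -- `q`.
  have key : ∀ y : H →L[ℂ] H, (∀ z ∈ P.D, z * y = y * z) → y * q = q * y * q := by
    intro y hy
    have := h2 (y - q * y) fun a ha => by
      rw [sub_mul, mul_assoc, ← hy a (hA a ha), ← mul_assoc, h1 a ha, sub_self]
    rwa [sub_mul, sub_eq_zero] at this
  have hy' : ∀ z ∈ P.D, z * star y = star y * z := fun z hz => by
    simpa using (congrArg star (hy _ (star_mem hz))).symm
  have h3 := congrArg star (key _ hy')
  simp only [star_mul, star_star, hq.isSelfAdjoint.star_eq] at h3
  rw [key y hy, mul_assoc, ← h3]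

/-- Elements of the commutative star algebra `D` are normal, and a normal idempotent is
self-adjoint. -/
theorem isStarProjection_of_mem_D {e : H →L[ℂ] H} (he : e ∈ P.D) (hee : e * e = e) :
    IsStarProjection e :=
  isStarProjection_iff_isIdempotentElem_and_isStarNormal.2
    ⟨hee, ⟨P.D_comm _ (star_mem he) _ he⟩⟩

theorem projection_mem_gn {e : H →L[ℂ] H} (he : e ∈ P.D) (hp : IsStarProjection e) :
    e ∈ groupoidNormalizers P.M P.D := by
  have hs := hp.isSelfAdjoint.star_eq
  have hi : e * e = e := hp.isIdempotentElem
  refine ⟨P.D_le e he, by rw [hs, hi, hi], fun d hd => ?_⟩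
  rw [hs]
  exact ⟨mul_mem (mul_mem he hd) he, mul_mem (mul_mem he hd) he⟩

theorem zero_mem_gn : (0 : H →L[ℂ] H) ∈ groupoidNormalizers P.M P.D :=
  P.projection_mem_gn (zero_mem _) (.zero _)

end CartanPair

/-! ### Conjugation by normalizers below a supremum, and gluing of orthogonal families. -/

namespace CartanPair

variable {H : Type u} [NormedAddCommGroup H] [InnerProductSpace ℂ H] [CompleteSpace H]
  (P : CartanPair H)

/-- If `q` is the range projection of a family `E` of elements of `D`, and the projection `r`
dominates the conjugates `v e v*`, then `r` dominates `v q v*`. -/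
theorem mul_range_projection {v q r : H →L[ℂ] H} (hv : v ∈ groupoidNormalizers P.M P.D)
    {E : Set (H →L[ℂ] H)} (hE : ∀ e ∈ E, e ∈ P.D)
    (hq : ∀ X : H →L[ℂ] H, (∀ e ∈ E, X * e = 0) → X * q = 0)
    (hr : ∀ e ∈ E, r * (v * e * star v) = v * e * star v) : r * (v * q) = v * q := by
  have h : ∀ e ∈ E, v * e * star v * v = v * e := fun e he => by
    rw [mul_assoc, mul_assoc, P.D_comm _ (hE e he) _ (P.star_mul_self_mem hv).1, ← mul_assoc,
      ← mul_assoc, hv.2.1]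
  -- Since `v e = (v e v*) v`, the operator `r v - v` kills every `e` in `E`, hence kills `q`.
  have := hq (r * v - v) fun e he => by
    rw [sub_mul, mul_assoc, ← h e he, ← mul_assoc r, hr e he, sub_self]
  rwa [sub_mul, mul_assoc, sub_eq_zero] at this

theorem conj_mul_conj {v d e : H →L[ℂ] H} (hv : v ∈ groupoidNormalizers P.M P.D)
    (hd : d ∈ P.D) : v * d * star v * (v * e * star v) = v * (d * e) * star v := by
  calc v * d * star v * (v * e * star v) = v * (d * (star v * v)) * e * star v := by
        simp only [mul_assoc]
    _ = v * star v * v * d * e * star v := by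
        rw [P.D_comm _ hd _ (P.star_mul_self_mem hv).1]; simp only [mul_assoc]
    _ = v * (d * e) * star v := by rw [hv.2.1, mul_assoc v]

/-- Two groupoid normalizers that act in the same way below each projection of a family act in the
same way below the supremum of the family. -/
theorem conj_range_projection_eq {v w q : H →L[ℂ] H} (hv : v ∈ groupoidNormalizers P.M P.D)
    (hw : w ∈ groupoidNormalizers P.M P.D) {E : Set (H →L[ℂ] H)}
    (hE : ∀ e ∈ E, e ∈ P.D ∧ IsStarProjection e) (hqD : q ∈ P.D) (hqp : IsStarProjection q)
    (hqE : ∀ e ∈ E, q * e = e)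
    (hq : ∀ X : H →L[ℂ] H, (∀ e ∈ E, X * e = 0) → X * q = 0)
    (h : ∀ e ∈ E, ∀ g ∈ P.D, IsStarProjection g →
      (v * e) * g * star (v * e) = (w * e) * g * star (w * e))
    {g : H →L[ℂ] H} (hg : g ∈ P.D) (hgp : IsStarProjection g) :
    (v * q) * g * star (v * q) = (w * q) * g * star (w * q) := by
  have hi : ∀ e ∈ E, e * e = e := fun e he => (hE e he).2.isIdempotentElem
  have hs : ∀ e ∈ E, star e = e := fun e he => (hE e he).2.isSelfAdjoint.star_eq
  have hqs : star q = q := hqp.isSelfAdjoint.star_eq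
  -- All conjugates are put in the form `x d x*` with `d` in `D`, where `conj_mul_conj` multiplies
  -- them.
  have hconj : ∀ (x : H →L[ℂ] H), ∀ e ∈ E, ∀ g ∈ P.D,
      (x * e) * g * star (x * e) = x * (g * e) * star x := fun x e he g hg => by
    rw [star_mul, hs e he]
    calc x * e * g * (e * star x) = x * ((e * g) * e) * star x := by simp only [mul_assoc]
      _ = x * (g * e) * star x := by rw [P.D_comm _ (hE e he).1 _ hg, mul_assoc g, hi e he]
  have hconj' : ∀ x : H →L[ℂ] H, (x * q) * g * star (x * q) = x * (q * g * q) * star x := fun x => by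
    rw [star_mul, hqs]; simp only [mul_assoc]
  have hvw : ∀ e ∈ E, v * e * star v = w * e * star w := fun e he => by
    simpa only [hconj _ e he 1 (one_mem _), one_mul] using h e he 1 (one_mem _) (.one _)
  set F : Set (H →L[ℂ] H) := (fun e => v * e * star v) '' E with hF
  have hFD : ∀ f ∈ F, f ∈ P.D := by
    rintro _ ⟨e, he, rfl⟩
    exact (hv.2.2 e (hE e he).1).1
  obtain ⟨r, hrD, hrp, hrF, hr⟩ := P.exists_range_projection_mem F hFD
  have hrs : star r = r := hrp.isSelfAdjoint.star_eq
  have hvr : r * (v * q) = v * q := P.mul_range_projection hv (fun e he => (hE e he).1) hq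
    fun e he => hrF _ ⟨e, he, rfl⟩
  have hwr : r * (w * q) = w * q := P.mul_range_projection hw (fun e he => (hE e he).1) hq
    fun e he => hrF _ ⟨e, he, hvw e he⟩
  have hvr' : star (v * q) * r = star (v * q) := by
    simpa only [star_mul, hrs] using congrArg star hvr
  have hwr' : star (w * q) * r = star (w * q) := by
    simpa only [star_mul, hrs] using congrArg star hwr
  have hqg : q * g * q ∈ P.D := mul_mem (mul_mem hqD hg) hqD
  have hqge : ∀ e ∈ E, q * g * q * e = g * e := fun e he => by
    rw [mul_assoc, hqE e he, mul_assoc, P.D_comm _ hg _ (hE e he).1, ← mul_assoc, hqE e he]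
  -- The difference `X` satisfies `X r = X`, so it suffices that `X` kills each `v e v* = w e w*`;
  -- there both terms reduce to the assumed equality below `e`.
  have hX := hr ((v * q) * g * star (v * q) - (w * q) * g * star (w * q)) (by
    rintro _ ⟨e, he, rfl⟩
    rw [sub_mul, hconj', hconj']
    simp only
    rw [P.conj_mul_conj hv hqg, hvw e he, P.conj_mul_conj hw hqg, hqge e he, ← hconj _ e he g hg,
      ← hconj _ e he g hg, h e he g hg hgp, sub_self])
  rwa [sub_mul, mul_assoc _ _ r, mul_assoc _ _ r, hvr', hwr', sub_eq_zero] at hX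

section Gluing

variable {P} {ι : Type*} {u : ι → H →L[ℂ] H} {v q r : H →L[ℂ] H}

/-- Here `v* u_i = u_i* u_i`, so `v* v - 1` kills every initial projection and therefore kills `q`.
-/
theorem star_mul_self_eq_of_glue
    (hq : ∀ X : H →L[ℂ] H, (∀ i, X * (star (u i) * u i) = 0) → X * q = 0)
    (h1 : ∀ i, v * (star (u i) * u i) = u i) (h2 : ∀ i, (u i * star (u i)) * v = u i)
    (hu : ∀ i, u i * star (u i) * u i = u i) (hvq : v * q = v) : star v * v = q := by
  have h3 : ∀ i, star v * u i = star (u i) * u i := fun i => by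
    have h4 : star (u i) * v = star (u i) * u i := by
      conv_lhs => rw [← star_partial (hu i), mul_assoc, mul_assoc, ← mul_assoc (u i), h2 i]
    simpa only [star_mul, star_star] using congrArg star h4
  have h5 := hq (star v * v - 1) fun i => by
    rw [sub_mul, mul_assoc, h1 i, h3 i, one_mul, sub_self]
  rwa [sub_mul, one_mul, mul_assoc, hvq, sub_eq_zero] at h5

/-- On the range of `u_i`, the operator `v d v*` agrees with `u_i d u_i*`, which is in `D`. So its
commutator with any element of `D` vanishes on each such range, hence everywhere because `r v = v`;
being its own relative commutant, `D` contains `v d v*`. -/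
theorem conj_mem_D_of_glue (hvM : v ∈ P.M) (hu : ∀ i, u i ∈ groupoidNormalizers P.M P.D)
    (hrD : r ∈ P.D) (hrp : IsStarProjection r)
    (hr : ∀ X : H →L[ℂ] H, (∀ i, X * (u i * star (u i)) = 0) → X * r = 0)
    (h1 : ∀ i, v * (star (u i) * u i) = u i) (h2 : ∀ i, (u i * star (u i)) * v = u i)
    (hrv : r * v = v) {d : H →L[ℂ] H} (hd : d ∈ P.D) : v * d * star v ∈ P.D := by
  have hrv' : star v * r = star v := by
    simpa only [star_mul, hrp.isSelfAdjoint.star_eq] using congrArg star hrv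
  have h2' : ∀ i, star v * (u i * star (u i)) = star (u i) := fun i => by
    simpa only [star_mul, star_star, mul_assoc] using congrArg star (h2 i)
  have h3 : ∀ i, v * d * star v * (u i * star (u i)) = u i * d * star (u i) := fun i => by
    calc v * d * star v * (u i * star (u i)) = v * d * star (u i) := by rw [mul_assoc, h2']
      _ = v * (d * (star (u i) * u i)) * star (u i) := by
          conv_lhs => rw [← star_partial (hu i).2.1]
          simp only [mul_assoc]
      _ = v * (star (u i) * u i) * d * star (u i) := by
          rw [P.D_comm _ hd _ (P.star_mul_self_mem (hu i)).1]
          simp only [mul_assoc]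
      _ = u i * d * star (u i) := by rw [h1]
  refine P.mem_D (mul_mem (mul_mem hvM (P.D_le d hd)) (star_mem hvM)) fun c hc => ?_
  have h4 := hr (c * (v * d * star v) - (v * d * star v) * c) fun i => by
    rw [sub_mul, mul_assoc c, h3, mul_assoc _ c, P.D_comm _ hc _ (P.star_mul_self_mem (hu i)).2,
      ← mul_assoc _ _ c, h3, P.D_comm _ hc _ ((hu i).2.2 d hd).1, sub_self]
  rwa [sub_mul, mul_assoc _ c, P.D_comm _ hc _ hrD, mul_assoc, mul_assoc _ _ r, hrv',
    ← mul_assoc _ r, mul_assoc _ _ r, hrv', sub_eq_zero] at h4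

end Gluing

/-- Pairwise orthogonal families of groupoid normalizers can be glued. -/
theorem exists_glue {ι : Type*} (u : ι → H →L[ℂ] H)
    (hu : ∀ i, u i ∈ groupoidNormalizers P.M P.D)
    (h1 : ∀ i j, i ≠ j → star (u i) * u j = 0) (h2 : ∀ i j, i ≠ j → u i * star (u j) = 0) :
    ∃ v ∈ groupoidNormalizers P.M P.D, (∀ i, v * (star (u i) * u i) = u i) ∧
      (∀ i, star v * v * (star (u i) * u i) = star (u i) * u i) ∧
      ∀ X : H →L[ℂ] H, (∀ i, X * (star (u i) * u i) = 0) → X * (star v * v) = 0 := by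
  classical
  let T : Finset ι → H →L[ℂ] H := fun F => ∑ i ∈ F, u i
  have hT1 : ∀ F, ∀ j ∈ F, T F * (star (u j) * u j) = u j := fun F j hj => by
    simp only [T]
    rw [Finset.sum_mul, Finset.sum_eq_single_of_mem j hj, ← mul_assoc, (hu j).2.1]
    intro i _ hij
    rw [← mul_assoc, h2 i j hij, zero_mul]
  have hT2 : ∀ F, ∀ j ∈ F, star (u j) * T F = star (u j) * u j := fun F j hj => by
    simp only [T]
    rw [Finset.mul_sum, Finset.sum_eq_single_of_mem j hj]
    exact fun i _ hij => h1 j i hij.symm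
  have hT2' : ∀ F, ∀ j ∈ F, (u j * star (u j)) * T F = u j := fun F j hj => by
    rw [mul_assoc, hT2 F j hj, ← mul_assoc, (hu j).2.1]
  -- Orthogonality makes the partial sums partial isometries, which bounds them uniformly by one.
  have hTp : ∀ F, T F * star (T F) * T F = T F := fun F => by
    have h3 : star (T F) * T F = ∑ j ∈ F, star (u j) * u j := by
      conv_lhs => enter [1]; simp only [T]
      rw [star_sum, Finset.sum_mul]
      exact Finset.sum_congr rfl (hT2 F)
    rw [mul_assoc, h3, Finset.mul_sum]
    exact Finset.sum_congr rfl (hT1 F)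
  -- Along an ultrafilter finer than `atTop` a weak limit exists by compactness, and it inherits
  -- every identity valid for all large `F`.
  let U : Ultrafilter (Finset ι) := Ultrafilter.of atTop
  have hU : (U : Filter (Finset ι)) ≤ atTop := Ultrafilter.of_le _
  have hev : ∀ i, ∀ᶠ F in (U : Filter (Finset ι)), i ∈ F := fun i =>
    hU ((eventually_ge_atTop ({i} : Finset ι)).mono fun F hF => hF (Finset.mem_singleton_self i))
  obtain ⟨v, hv⟩ := exists_weak_limit U T 1
    (Eventually.of_forall fun F => norm_le_one_of_mul_star_mul (hTp F))
  have hvM : v ∈ P.M := P.mem_M_of_tendstoWeakly hv fun F => sum_mem fun i _ => (hu i).1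
  have hv1 : ∀ i, v * (star (u i) * u i) = u i := fun i => (hv.mul_right _).unique
    (.of_eventually_eq ((hev i).mono fun F hF => hT1 F i hF))
  have hv2 : ∀ i, (u i * star (u i)) * v = u i := fun i => (hv.mul_left _).unique
    (.of_eventually_eq ((hev i).mono fun F hF => hT2' F i hF))
  obtain ⟨q, hqD, hqp, hqE, hq⟩ := P.exists_range_projection_mem
    (Set.range fun i => star (u i) * u i) (by
      rintro _ ⟨i, rfl⟩
      exact (P.star_mul_self_mem (hu i)).1)
  obtain ⟨r, hrD, hrp, hrE, hr⟩ := P.exists_range_projection_mem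
    (Set.range fun i => u i * star (u i)) (by
      rintro _ ⟨i, rfl⟩
      exact (P.star_mul_self_mem (hu i)).2)
  simp only [Set.forall_mem_range] at hqE hq hrE hr
  have hrv : r * v = v := (hv.mul_left r).unique (hv.congr (Eventually.of_forall fun F => by
    simp only [T]
    rw [Finset.mul_sum]
    refine Finset.sum_congr rfl fun i _ => ?_
    rw [← (hu i).2.1, ← mul_assoc, hrE i]))
  have hvq : v * q = v := (hv.mul_right q).unique (hv.congr (Eventually.of_forall fun F => by
    simp only [T]
    rw [Finset.sum_mul]
    refine Finset.sum_congr rfl fun i _ => ?_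
    rw [← (hu i).2.1, mul_assoc, mul_assoc, ← mul_assoc,
      P.D_comm _ (P.star_mul_self_mem (hu i)).1 _ hqD, hqE i, mul_assoc]))
  have hvq' : q * star v = star v := by
    simpa only [star_mul, hqp.isSelfAdjoint.star_eq] using congrArg star hvq
  have hsv : star v * v = q :=
    star_mul_self_eq_of_glue hq hv1 hv2 (fun i => (hu i).2.1) hvq
  -- The adjoint `v*` glues the family `u_i*`, with `q` and `r` exchanged, so conjugation by `v*` is
  -- covered by the same lemma.
  have hs1 : ∀ i, star v * (star (star (u i)) * star (u i)) = star (u i) := fun i => by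
    simpa only [star_mul, star_star, mul_assoc] using congrArg star (hv2 i)
  have hs2 : ∀ i, (star (u i) * star (star (u i))) * star v = star (u i) := fun i => by
    simpa only [star_mul, star_star, mul_assoc] using congrArg star (hv1 i)
  refine ⟨v, ⟨hvM, by rw [mul_assoc, hsv, hvq], fun d hd => ⟨?_, ?_⟩⟩, hv1, by rwa [hsv], by rwa [hsv]⟩
  · exact conj_mem_D_of_glue hvM hu hrD hrp hr hv1 hv2 hrv hd
  · have := conj_mem_D_of_glue (star_mem hvM) (fun i => P.star_mem_gn (hu i)) hqD hqp
      (by simpa only [star_star] using hq) hs1 hs2 hvq' hd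
    rwa [star_star] at this

end CartanPair

/-! ### Natural order, zero and orthogonality in inverse monoids. -/

namespace InverseMonoid

variable {S : Type u} [InverseMonoid S]

/-- The idempotent witnessing the order can always be taken to be `s⁻¹ * s`, which depends on `s`
alone. -/
theorem le_iff_eq_mul_inv_mul {s t : S} : s ≤ t ↔ s = t * (s⁻¹ * s) := by
  refine ⟨?_, fun h => ⟨_, inv_mul_idem s, h⟩⟩
  rintro ⟨e, he, rfl⟩
  have h1 : t * e * e = t * e := by rw [mul_assoc, he]
  calc t * e = t * e * ((t * e)⁻¹ * (t * e)) := by rw [← mul_assoc, mul_inv_mul]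
    _ = t * ((t * e)⁻¹ * (t * e * e)) := by
        rw [mul_assoc t e, idem_comm e _ he (inv_mul_idem (t * e)), mul_assoc (t * e)⁻¹]
    _ = t * ((t * e)⁻¹ * (t * e)) := by rw [h1]

theorem mul_idem_le (s e : S) (he : e * e = e) : s * e ≤ s := ⟨e, he, rfl⟩

theorem IsZeroElem.eq {z w : S} (hz : IsZeroElem z) (hw : IsZeroElem w) : z = w := by
  rw [← (hw z).1, (hz w).2]

theorem IsZeroElem.inv {z : S} (hz : IsZeroElem z) : IsZeroElem z⁻¹ := by
  have : z⁻¹ = z := (eq_inv z z (hz _).1 (hz _).1).symm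
  rwa [this]

theorem Orthogonal.symm {s t : S} (h : Orthogonal s t) : Orthogonal t s := by
  constructor
  · simpa only [mul_inv_rev', inv_inv'] using h.1.inv
  · simpa only [mul_inv_rev', inv_inv'] using h.2.inv

end InverseMonoid

/-! ### The Munn quotient `S`: fundamentality, joins and meets. -/

namespace CartanPair

open InverseMonoid

variable {H : Type u} [NormedAddCommGroup H] [InnerProductSpace ℂ H] [CompleteSpace H]
  (P : CartanPair H)

/-- The class of a groupoid normalizer in the quotient by the Munn congruence. -/
def munnClass (v : P.G) : P.S := (v : (munnCon P.G).Quotient)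

theorem munnClass_surjective : Function.Surjective P.munnClass := fun s => by
  induction s using Con.induction_on with
  | H x => exact ⟨x, rfl⟩

theorem munnClass_mul (v w : P.G) : P.munnClass (v * w) = P.munnClass v * P.munnClass w := rfl

theorem munnClass_inv (v : P.G) : P.munnClass v⁻¹ = (P.munnClass v)⁻¹ := rfl

theorem munnClass_eq_iff_munn {v w : P.G} :
    P.munnClass v = P.munnClass w ↔ ∀ e : P.G, e * e = e → v * e * v⁻¹ = w * e * w⁻¹ :=
  Con.eq _

theorem munnClass_eq_iff {v w : P.G} : P.munnClass v = P.munnClass w ↔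
    ∀ e ∈ P.D, IsStarProjection e → v.1 * e * star v.1 = w.1 * e * star w.1 := by
  rw [munnClass_eq_iff_munn]
  constructor
  · intro h e he hp
    exact congrArg Subtype.val (h ⟨e, P.projection_mem_gn he hp⟩ (Subtype.ext hp.isIdempotentElem))
  · intro h e he
    have he' : e.1 * e.1 = e.1 := congrArg Subtype.val he
    exact Subtype.ext (h e.1 (P.idem_mem_D e.2 he')
      (P.isStarProjection_of_mem_D (P.idem_mem_D e.2 he') he'))

/-- An idempotent is recovered from its action by conjugating `1`. -/
theorem munnClass_eq_of_idem {e f : P.G} (he : e * e = e) (hf : f * f = f) (h : P.munnClass e = P.munnClass f) :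
    e = f := by
  have hinv : ∀ x : P.G, x * x = x → x⁻¹ = x := fun x hx =>
    (eq_inv x x (by rw [hx, hx]) (by rw [hx, hx])).symm
  have := P.munnClass_eq_iff_munn.1 h 1 (one_mul 1)
  rwa [mul_one, mul_one, hinv e he, hinv f hf, he, hf] at this

theorem exists_idem_of_idem (a : P.S) (ha : a * a = a) : ∃ e : P.G, e * e = e ∧ P.munnClass e = a :=
  munnCon_idem_lift a ha

instance : Zero P.G := ⟨⟨0, P.zero_mem_gn⟩⟩

theorem G_mul_zero (v : P.G) : v * 0 = 0 := Subtype.ext (mul_zero v.1)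

theorem G_zero_mul (v : P.G) : 0 * v = 0 := Subtype.ext (zero_mul v.1)

theorem isZeroElem_munnClass_zero : IsZeroElem (P.munnClass 0) := fun s => by
  obtain ⟨v, rfl⟩ := P.munnClass_surjective s
  rw [← munnClass_mul, ← munnClass_mul, G_mul_zero, G_zero_mul]
  exact ⟨rfl, rfl⟩

theorem eq_zero_of_isZeroElem {v : P.G} (hv : IsZeroElem (P.munnClass v)) : v = 0 := by
  have h := P.munnClass_eq_iff.1 (hv.eq P.isZeroElem_munnClass_zero) 1 (one_mem _) (.one _)
  refine Subtype.ext (CStarRing.mul_star_self_eq_zero_iff _ |>.1 ?_)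
  rw [mul_one] at h
  rw [h]
  exact (congrArg (· * _) (zero_mul _)).trans (zero_mul _)

/-- The conjugates of an idempotent are idempotents of `G`, so their equality in `S` is already
equality in `G`. -/
theorem fundamental_S : IsFundamental P.S := fun s t h => by
  obtain ⟨v, rfl⟩ := P.munnClass_surjective s
  obtain ⟨w, rfl⟩ := P.munnClass_surjective t
  refine P.munnClass_eq_iff_munn.2 fun e he => P.munnClass_eq_of_idem (conj_idem v e he) (conj_idem w e he) ?_
  simp only [munnClass_mul, munnClass_inv]
  exact h _ (by rw [← munnClass_mul, he])

/-- The Boolean algebra of idempotents of `D`. -/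
def Projections : Type u := {a : P.D // IsIdempotentElem a}

instance : BooleanAlgebra P.Projections :=
  inferInstanceAs (BooleanAlgebra {a : P.D // IsIdempotentElem a})

variable {P} in
theorem projections_le_iff {a b : P.Projections} : a ≤ b ↔ b.1.1 * a.1.1 = a.1.1 := by
  change a.1 * b.1 = a.1 ↔ _
  rw [mul_comm]
  exact ⟨congrArg Subtype.val, fun h => Subtype.ext h⟩

/-- The idempotent of `S` defined by an idempotent of `D`. -/
def toIdem (a : P.Projections) : Idem P.S :=
  have h : a.1.1 * a.1.1 = a.1.1 := congrArg Subtype.val a.2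
  ⟨P.munnClass ⟨a.1.1, P.projection_mem_gn a.1.2 (P.isStarProjection_of_mem_D a.1.2 h)⟩,
    congrArg P.munnClass (Subtype.ext h)⟩

theorem toIdem_surjective : Function.Surjective P.toIdem := fun ⟨a, ha⟩ => by
  obtain ⟨e, he, rfl⟩ := P.exists_idem_of_idem a ha
  have he' : e.1 * e.1 = e.1 := congrArg Subtype.val he
  exact ⟨⟨⟨e.1, P.idem_mem_D e.2 he'⟩, Subtype.ext he'⟩, rfl⟩

theorem toIdem_le_iff {a b : P.Projections} :
    P.toIdem a ≤ P.toIdem b ↔ a ≤ b := by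
  have ha : (P.toIdem a).1 * (P.toIdem a).1 = (P.toIdem a).1 := (P.toIdem a).2
  have hb : (P.toIdem b).1 * (P.toIdem b).1 = (P.toIdem b).1 := (P.toIdem b).2
  have key : P.toIdem a ≤ P.toIdem b ↔ (P.toIdem a).1 * (P.toIdem b).1 = (P.toIdem a).1 := by
    change (∃ e : P.S, e * e = e ∧ (P.toIdem a).1 = (P.toIdem b).1 * e) ↔ _
    constructor
    · rintro ⟨e, he, h⟩
      rw [idem_comm _ _ ha hb, h, ← mul_assoc, hb]
    · intro h
      exact ⟨_, ha, by rw [idem_comm _ _ hb ha, h]⟩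
  rw [key, idem_comm _ _ ha hb, projections_le_iff]
  constructor
  · intro h
    have h1 := P.munnClass_eq_of_idem (e := ⟨b.1.1 * a.1.1, _⟩) (f := ⟨a.1.1, _⟩) ?_ ?_ h
    · exact congrArg Subtype.val h1
    · exact Subtype.ext (congrArg (fun x : P.D => (x : H →L[ℂ] H)) (b.2.mul a.2))
    · exact Subtype.ext (congrArg (fun x : P.D => (x : H →L[ℂ] H)) a.2)
  · exact fun h => congrArg P.munnClass (Subtype.ext h)

/-- The idempotents of `S` are the idempotents of `D`. -/
def idemEquiv : P.Projections ≃o Idem P.S :=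
  RelIso.ofSurjective (OrderEmbedding.ofMapLEIff P.toIdem fun _ _ => P.toIdem_le_iff)
    P.toIdem_surjective

theorem exists_isLUB_idem (A : Set P.Projections) : ∃ q, IsLUB A q := by
  obtain ⟨q, hqD, hqp, hqE, hq⟩ := P.exists_range_projection_mem
    ((fun a : P.Projections => (a.1.1 : H →L[ℂ] H)) '' A) (by
      rintro _ ⟨a, -, rfl⟩
      exact a.1.2)
  refine ⟨⟨⟨q, hqD⟩, Subtype.ext hqp.isIdempotentElem⟩, fun a ha => ?_, fun b hb => ?_⟩
  · exact projections_le_iff.2 (hqE _ ⟨a, ha, rfl⟩)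
  · have h1 := hq (b.1.1 - 1) (by
      rintro _ ⟨a, ha, rfl⟩
      simp only
      rw [sub_mul, one_mul, projections_le_iff.1 (hb ha), sub_self])
    rw [sub_mul, one_mul, sub_eq_zero] at h1
    exact projections_le_iff.2 h1

theorem exists_isLUB_of_orthogonal (A : Set P.S) (hA : A.Pairwise Orthogonal) :
    ∃ j : P.S, IsLUB A j := by
  choose u hu using P.munnClass_surjective
  have hA1 : ∀ i j : A, i ≠ j → star (u i).1 * (u j).1 = 0 := fun i j hij => by
    have := (hA i.2 j.2 fun h => hij (Subtype.ext h)).1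
    rw [← hu i.1, ← hu j.1, ← munnClass_inv, ← munnClass_mul] at this
    exact congrArg Subtype.val (P.eq_zero_of_isZeroElem this)
  have hA2 : ∀ i j : A, i ≠ j → (u i).1 * star (u j).1 = 0 := fun i j hij => by
    -- The second half of `Orthogonal s t` concerns `t * s⁻¹`, hence the exchanged indices.
    have := (hA j.2 i.2 fun h => hij (Subtype.ext h.symm)).2
    rw [← hu i.1, ← hu j.1, ← munnClass_inv, ← munnClass_mul] at this
    exact congrArg Subtype.val (P.eq_zero_of_isZeroElem this)
  obtain ⟨v, hv, hv1, hvE, hv2⟩ := P.exists_glue (fun i : A => (u i).1) (fun i => (u i).2) hA1 hA2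
  let v' : P.G := ⟨v, hv⟩
  have hle : ∀ s : A, u s = v' * ((u s)⁻¹ * u s) := fun s => Subtype.ext (hv1 s).symm
  refine ⟨P.munnClass v', fun s hs => ?_, fun t ht => ?_⟩
  · refine ⟨s⁻¹ * s, inv_mul_idem s, ?_⟩
    have := congrArg P.munnClass (hle ⟨s, hs⟩)
    rwa [munnClass_mul, munnClass_mul, munnClass_inv, hu] at this
  · obtain ⟨w, rfl⟩ := P.munnClass_surjective t
    have hq := P.star_mul_self_mem hv
    have hqi : star v * v * (star v * v) = star v * v := by rw [← mul_assoc, star_partial hv.2.1]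
    have hqp := P.isStarProjection_of_mem_D hq.1 hqi
    have hes : ∀ s : A, star (u s).1 * (u s).1 ∈ P.D := fun s => (P.star_mul_self_mem (u s).2).1
    -- An upper bound `w` acts like `v` below each initial projection `u_s* u_s`, hence below their
    -- supremum `v* v`.
    have key : P.munnClass v' = P.munnClass (w * (v'⁻¹ * v')) := by
      refine P.munnClass_eq_iff.2 fun g hg hgp => ?_
      have := P.conj_range_projection_eq hv w.2
        (E := Set.range fun s : A => star (u s).1 * (u s).1) ?_ hq.1 hqp ?_ ?_ ?_ hg hgp
      · rw [← mul_assoc v, hv.2.1] at this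
        exact this
      · rintro _ ⟨s, rfl⟩
        refine ⟨hes s, P.isStarProjection_of_mem_D (hes s) ?_⟩
        exact congrArg Subtype.val (inv_mul_idem (u s))
      · rintro _ ⟨s, rfl⟩
        exact hvE s
      · intro X hX
        exact hv2 X fun s => hX _ ⟨s, rfl⟩
      · rintro _ ⟨s, rfl⟩ g hg hgp
        have h1 := le_iff_eq_mul_inv_mul.1 (ht s.2)
        rw [← hu s.1, ← munnClass_inv, ← munnClass_mul, ← munnClass_mul] at h1
        simp only [hv1]
        exact P.munnClass_eq_iff.1 h1 g hg hgp
    rw [key, munnClass_mul]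
    exact mul_idem_le _ _ (by rw [← munnClass_mul, inv_mul_idem])

theorem exists_isGLB (s t : P.S) : ∃ m : P.S, IsGLB {s, t} m := by
  obtain ⟨v, rfl⟩ := P.munnClass_surjective s
  obtain ⟨w, rfl⟩ := P.munnClass_surjective t
  -- The projections below which `v` and `w` act alike. The domain idempotent of any common lower
  -- bound lies in `E`, so cutting `v` down to the supremum `q` gives the meet.
  let E : Set (H →L[ℂ] H) := {e | e ∈ P.D ∧ IsStarProjection e ∧ ∀ g ∈ P.D, IsStarProjection g →
      (v.1 * e) * g * star (v.1 * e) = (w.1 * e) * g * star (w.1 * e)}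
  obtain ⟨q, hqD, hqp, hqE, hq⟩ := P.exists_range_projection_mem E fun e he => he.1
  let q' : P.G := ⟨q, P.projection_mem_gn hqD hqp⟩
  have hq' : q' * q' = q' := Subtype.ext hqp.isIdempotentElem
  have hvw : P.munnClass (v * q') = P.munnClass (w * q') := P.munnClass_eq_iff.2 fun g hg hgp =>
    P.conj_range_projection_eq v.2 w.2 (E := E) (fun e he => ⟨he.1, he.2.1⟩) hqD hqp hqE hq
      (fun e he => he.2.2) hg hgp
  have hmq : P.munnClass q' * P.munnClass q' = P.munnClass q' := congrArg P.munnClass hq'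
  refine ⟨P.munnClass (v * q'), ?_, fun n hn => ?_⟩
  · rintro x (rfl | rfl)
    · exact mul_idem_le (P.munnClass _) (P.munnClass q') hmq
    · rw [hvw]
      exact mul_idem_le (P.munnClass _) (P.munnClass q') hmq
  · have h1 := le_iff_eq_mul_inv_mul.1 (hn (Set.mem_insert _ _))
    have h2 := le_iff_eq_mul_inv_mul.1 (hn (Set.mem_insert_of_mem _ rfl))
    obtain ⟨e, he, hen⟩ := P.exists_idem_of_idem _ (inv_mul_idem n)
    rw [← hen, ← munnClass_mul] at h1 h2
    have he' : e.1 * e.1 = e.1 := congrArg Subtype.val he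
    have heD := P.idem_mem_D e.2 he'
    have heE : e.1 ∈ E := ⟨heD, P.isStarProjection_of_mem_D heD he', fun g hg hgp =>
      P.munnClass_eq_iff.1 (h1.symm.trans h2) g hg hgp⟩
    have h3 : q' * e = e := Subtype.ext (hqE _ heE)
    refine ⟨P.munnClass e, congrArg P.munnClass he, ?_⟩
    rw [← munnClass_mul, mul_assoc, h3, h1]

theorem isCompleteBoolean_S : IsCompleteBoolean P.S where
  exists_zero := ⟨_, P.isZeroElem_munnClass_zero⟩
  idem_boolean := ⟨_, inferInstance, ⟨P.idemEquiv.symm⟩⟩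
  exists_meet := P.exists_isGLB
  exists_join s t h := P.exists_isLUB_of_orthogonal {s, t}
    (by
      rintro a (rfl | rfl) b (rfl | rfl) hab
      exacts [(hab rfl).elim, h, h.symm, (hab rfl).elim])
  idem_complete A := by
    obtain ⟨q, hq⟩ := P.exists_isLUB_idem (P.idemEquiv ⁻¹' A)
    exact ⟨P.idemEquiv q, by simpa using P.idemEquiv.isLUB_image'.2 hq⟩
  exists_sSup := P.exists_isLUB_of_orthogonal

end CartanPair

/-! ### The Gelfand spectrum of `D` as the character space of the idempotents. -/

namespace CartanPair

open InverseMonoid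

variable {H : Type u} [NormedAddCommGroup H] [InnerProductSpace ℂ H] [CompleteSpace H]
  (P : CartanPair H)

/-- The Gelfand spectrum of `D`. -/
abbrev Spec : Type u := WeakDual.characterSpace ℂ P.D

variable {P} in
theorem spec_continuous (a : P.D) : Continuous fun φ : P.Spec => φ a :=
  (gelfandStarTransform P.D a).continuous

variable {P} in
theorem spec_ext {a b : P.D} (h : ∀ φ : P.Spec, φ a = φ b) : a = b :=
  (gelfandStarTransform P.D).injective (ContinuousMap.ext h)

/-- The element of `D` with a given real Gelfand transform. -/
def ofSpec (f : C(P.Spec, ℝ)) : P.D :=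
  (gelfandStarTransform P.D).symm ((⟨Complex.ofReal, Complex.continuous_ofReal⟩ : C(ℝ, ℂ)).comp f)

@[simp]
theorem spec_ofSpec (f : C(P.Spec, ℝ)) (φ : P.Spec) : φ (P.ofSpec f) = (f φ : ℂ) :=
  congrArg (fun g : C(P.Spec, ℂ) => g φ) ((gelfandStarTransform P.D).apply_symm_apply _)

/-- A continuous function that vanishes off an open set and is one at a given point of it. -/
theorem exists_spec_bump {U : Set P.Spec} (hU : IsOpen U) {φ : P.Spec} (hφ : φ ∈ U) :
    ∃ b : P.D, φ b = 1 ∧ ∀ ψ ∉ U, ψ b = 0 := by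
  obtain ⟨f, hf0, hf1, -⟩ := exists_continuous_zero_one_of_isClosed hU.isClosed_compl
    (isClosed_singleton (x := φ)) (Set.disjoint_singleton_right.2 fun h => h hφ)
  refine ⟨P.ofSpec f, ?_, fun ψ hψ => ?_⟩
  · rw [spec_ofSpec, hf1 rfl]; simp
  · rw [spec_ofSpec, hf0 hψ]; simp

variable {P} in
theorem spec_idem (φ : P.Spec) (a : P.Projections) : φ a.1 = 0 ∨ φ a.1 = 1 := by
  have h : φ a.1 * φ a.1 = φ a.1 := by
    rw [← map_mul]
    exact congrArg φ a.2
  exact IsIdempotentElem.iff_eq_zero_or_one.1 h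

theorem isClopen_spec_idem (a : P.Projections) : IsClopen {φ : P.Spec | φ a.1 = 1} := by
  refine ⟨isClosed_eq (spec_continuous a.1) continuous_const, ?_⟩
  have : {φ : P.Spec | φ a.1 = 1} = {φ : P.Spec | φ a.1 ≠ 0} := by
    ext φ
    rcases spec_idem φ a with h | h <;> simp [h]
  rw [this]
  exact isOpen_ne_fun (spec_continuous a.1) continuous_const

/-- The closure of an open set in the spectrum of `D` is the support of a projection of `D`. -/
theorem exists_projection_closure {U : Set P.Spec} (hU : IsOpen U) :
    ∃ a : P.Projections, closure U = {φ : P.Spec | φ a.1 = 1} := by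
  -- The projection sought is the range projection of the ideal of elements whose transform vanishes
  -- off `U`.
  obtain ⟨q, hqD, hqp, hqE, hq⟩ := P.exists_range_projection_mem
    ((fun a : P.D => (a : H →L[ℂ] H)) '' {a | ∀ ψ ∉ U, (ψ : P.Spec) a = 0}) (by
      rintro _ ⟨a, -, rfl⟩
      exact a.2)
  let a : P.Projections := ⟨⟨q, hqD⟩, Subtype.ext hqp.isIdempotentElem⟩
  refine ⟨a, subset_antisymm (closure_minimal (fun φ hφ => ?_) (P.isClopen_spec_idem a).1) ?_⟩
  · obtain ⟨b, hb1, hb0⟩ := P.exists_spec_bump hU hφ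
    have h1 : a.1 * b = b := Subtype.ext (hqE _ ⟨b, hb0, rfl⟩)
    have h2 := congrArg φ h1
    rwa [map_mul, hb1, mul_one] at h2
  · intro φ hφ
    by_contra hcl
    -- A bump off the closure of `U` annihilates the ideal, hence also `q`, which contradicts `φ q =
    -- 1`.
    obtain ⟨b, hb1, hb0⟩ := P.exists_spec_bump isClosed_closure.isOpen_compl hcl
    have h1 : b * a.1 = 0 := Subtype.ext (hq b.1 (by
      rintro _ ⟨c, hc, rfl⟩
      have : b * c = 0 := spec_ext fun ψ => by
        rw [map_mul, map_zero]
        by_cases hψ : ψ ∈ U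
        · rw [hb0 ψ fun h => h (subset_closure hψ), zero_mul]
        · rw [hc ψ hψ, mul_zero]
      exact congrArg Subtype.val this))
    have h2 := congrArg φ h1
    rw [map_mul, hb1, one_mul, map_zero] at h2
    exact one_ne_zero (hφ.symm.trans h2)

instance extremallyDisconnected_spec : ExtremallyDisconnected P.Spec where
  open_closure U hU := by
    obtain ⟨a, ha⟩ := P.exists_projection_closure hU
    rw [ha]
    exact (P.isClopen_spec_idem a).2

/-- The extremally disconnected Hausdorff spectrum is totally separated, and its clopen sets are
supports of projections. -/
theorem exists_projection_separating {φ ψ : P.Spec} (h : φ ≠ ψ) :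
    ∃ a : P.Projections, φ a.1 = 1 ∧ ψ a.1 = 0 := by
  obtain ⟨V, hV, hφ, hψ⟩ := exists_isClopen_of_totally_separated h
  obtain ⟨a, ha⟩ := P.exists_projection_closure hV.2
  rw [hV.1.closure_eq] at ha
  subst ha
  exact ⟨a, hφ, (spec_idem ψ a).resolve_right hψ⟩

section Characters

variable {P}

theorem isGLB_idemEquiv (a b : P.Projections) :
    IsGLB {P.idemEquiv a, P.idemEquiv b} (P.idemEquiv (a ⊓ b)) := by
  rw [← Set.image_pair]
  exact P.idemEquiv.isGLB_image'.2 isGLB_pair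

theorem isLUB_idemEquiv (a b : P.Projections) :
    IsLUB {P.idemEquiv a, P.idemEquiv b} (P.idemEquiv (a ⊔ b)) := by
  rw [← Set.image_pair]
  exact P.idemEquiv.isLUB_image'.2 isLUB_pair

theorem isTop_idemEquiv : IsTop (P.idemEquiv ⊤) := fun e => by
  obtain ⟨a, rfl⟩ := P.idemEquiv.surjective e
  exact P.idemEquiv.le_iff_le.2 le_top

theorem isBot_idemEquiv : IsBot (P.idemEquiv ⊥) := fun e => by
  obtain ⟨a, rfl⟩ := P.idemEquiv.surjective e
  exact P.idemEquiv.le_iff_le.2 bot_le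

theorem character_compl (ρ : LatticeCharacter (Idem P.S)) (a : P.Projections) :
    ρ.toFun (P.idemEquiv aᶜ) = !ρ.toFun (P.idemEquiv a) := by
  have h1 := ρ.map_inf _ _ _ (isGLB_idemEquiv a aᶜ)
  have h2 := ρ.map_sup _ _ _ (isLUB_idemEquiv a aᶜ)
  rw [inf_compl_self, ρ.map_bot _ isBot_idemEquiv] at h1
  rw [sup_compl_eq_top, ρ.map_top _ isTop_idemEquiv] at h2
  revert h1 h2
  generalize ρ.toFun (P.idemEquiv a) = x, ρ.toFun (P.idemEquiv aᶜ) = y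
  cases x <;> cases y <;> decide

theorem spec_inf (φ : P.Spec) (a b : P.Projections) : φ (a ⊓ b).1 = φ a.1 * φ b.1 :=
  map_mul φ a.1 b.1

theorem spec_sup (φ : P.Spec) (a b : P.Projections) :
    φ (a ⊔ b).1 = φ a.1 + φ b.1 - φ a.1 * φ b.1 := by
  change φ (a.1 + b.1 - a.1 * b.1) = _
  rw [map_sub, map_add, map_mul]

theorem spec_compl (φ : P.Spec) (a : P.Projections) : φ aᶜ.1 = 1 - φ a.1 := by
  change φ (1 - a.1) = _
  rw [map_sub, map_one]

open Classical in
/-- The lattice character defined by a point of the spectrum of `D`. -/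
def specToCharacter (φ : P.Spec) : LatticeCharacter (Idem P.S) where
  toFun e := decide (φ (P.idemEquiv.symm e).1 = 1)
  map_inf e f g h := by
    obtain ⟨a, rfl⟩ := P.idemEquiv.surjective e
    obtain ⟨b, rfl⟩ := P.idemEquiv.surjective f
    obtain rfl := h.unique (isGLB_idemEquiv a b)
    simp only [OrderIso.symm_apply_apply, spec_inf]
    rcases spec_idem φ a with ha | ha <;> rcases spec_idem φ b with hb | hb <;> simp [ha, hb]
  map_sup e f g h := by
    obtain ⟨a, rfl⟩ := P.idemEquiv.surjective e
    obtain ⟨b, rfl⟩ := P.idemEquiv.surjective f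
    obtain rfl := h.unique (isLUB_idemEquiv a b)
    simp only [OrderIso.symm_apply_apply, spec_sup]
    rcases spec_idem φ a with ha | ha <;> rcases spec_idem φ b with hb | hb <;> simp [ha, hb]
  map_top e h := by
    obtain rfl : e = P.idemEquiv ⊤ := le_antisymm (isTop_idemEquiv e) (h _)
    rw [OrderIso.symm_apply_apply]
    exact decide_eq_true (map_one φ)
  map_bot e h := by
    obtain rfl : e = P.idemEquiv ⊥ := le_antisymm (h _) (isBot_idemEquiv e)
    rw [OrderIso.symm_apply_apply]
    refine decide_eq_false fun h => zero_ne_one (α := ℂ) ?_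
    rw [← h]
    exact (map_zero φ).symm

theorem specToCharacter_eq_true (φ : P.Spec) (a : P.Projections) :
    (specToCharacter φ).toFun (P.idemEquiv a) = true ↔ φ a.1 = 1 := by
  simp [specToCharacter]

theorem specToCharacter_injective : Function.Injective (specToCharacter (P := P)) := by
  intro φ ψ h
  by_contra hne
  obtain ⟨a, ha, hb⟩ := P.exists_projection_separating hne
  have h1 := (specToCharacter_eq_true φ a).2 ha
  rw [h, specToCharacter_eq_true, hb] at h1
  exact zero_ne_one h1

/-- The projections sent to one by `ρ` form a proper filter, so by compactness their supports share
a point `φ`. Since `ρ` takes the value one at `a` or at its complement, `φ` induces exactly `ρ`. -/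
theorem specToCharacter_surjective : Function.Surjective (specToCharacter (P := P)) := by
  intro ρ
  let I : Type u := {a : P.Projections // ρ.toFun (P.idemEquiv a) = true}
  have : Nonempty I := ⟨⟨⊤, ρ.map_top _ isTop_idemEquiv⟩⟩
  have hclosed : ∀ i : I, IsClosed {φ : P.Spec | φ i.1.1 = 1} :=
    fun i => (P.isClopen_spec_idem i.1).1
  have hdir : Directed (· ⊇ ·) fun i : I => {φ : P.Spec | φ i.1.1 = 1} := fun i j => by
    refine ⟨⟨i.1 ⊓ j.1, ?_⟩, fun φ hφ => ?_, fun φ hφ => ?_⟩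
    · rw [ρ.map_inf _ _ _ (isGLB_idemEquiv i.1 j.1), i.2, j.2]; rfl
    · have h : φ (i.1 ⊓ j.1).1 = 1 := hφ
      rw [spec_inf] at h
      refine (spec_idem φ i.1).resolve_left fun h0 => ?_
      rw [h0, zero_mul] at h
      exact zero_ne_one h
    · have h : φ (i.1 ⊓ j.1).1 = 1 := hφ
      rw [spec_inf] at h
      refine (spec_idem φ j.1).resolve_left fun h0 => ?_
      rw [h0, mul_zero] at h
      exact zero_ne_one h
  have hne : ∀ i : I, {φ : P.Spec | φ i.1.1 = 1}.Nonempty := fun i => by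
    by_contra hne
    have h0 : i.1 = ⊥ := Subtype.ext (spec_ext fun φ =>
      ((spec_idem φ i.1).resolve_right fun h => hne ⟨φ, h⟩).trans (map_zero φ).symm)
    have := i.2
    rw [h0, ρ.map_bot _ isBot_idemEquiv] at this
    exact Bool.false_ne_true this
  obtain ⟨φ, hφ⟩ := IsCompact.nonempty_iInter_of_directed_nonempty_isCompact_isClosed _ hdir hne
    (fun i => (hclosed i).isCompact) hclosed
  rw [Set.mem_iInter] at hφ
  refine ⟨φ, LatticeCharacter.ext (funext fun e => ?_)⟩
  obtain ⟨a, rfl⟩ := P.idemEquiv.surjective e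
  rw [Bool.eq_iff_iff, specToCharacter_eq_true]
  refine ⟨fun h => ?_, fun h => hφ ⟨a, h⟩⟩
  by_contra ha
  have h1 : φ aᶜ.1 = 1 := hφ ⟨aᶜ, by rw [character_compl]; simpa using ha⟩
  rw [spec_compl, h, sub_self] at h1
  exact zero_ne_one h1

theorem isOpen_character (e : Idem P.S) :
    IsOpen {ρ : LatticeCharacter (Idem P.S) | ρ.toFun e = true} :=
  TopologicalSpace.isOpen_generateFrom_of_mem ⟨e, rfl⟩

theorem continuous_specToCharacter : Continuous (specToCharacter (P := P)) := by
  refine continuous_generateFrom_iff.2 ?_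
  rintro _ ⟨e, rfl⟩
  obtain ⟨a, rfl⟩ := P.idemEquiv.surjective e
  simpa only [Set.preimage_ofPred_eq, specToCharacter_eq_true] using (P.isClopen_spec_idem a).2

instance t2Space_character : T2Space (LatticeCharacter (Idem P.S)) := by
  have key : ∀ (ρ σ : LatticeCharacter (Idem P.S)) (e : Idem P.S), ρ.toFun e = true →
      σ.toFun e = false → ∃ u v : Set (LatticeCharacter (Idem P.S)),
        IsOpen u ∧ IsOpen v ∧ ρ ∈ u ∧ σ ∈ v ∧ Disjoint u v := by
    intro ρ σ e hρ hσ
    obtain ⟨a, rfl⟩ := P.idemEquiv.surjective e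
    refine ⟨_, _, isOpen_character (P.idemEquiv a), isOpen_character (P.idemEquiv aᶜ), hρ, ?_, ?_⟩
    · change σ.toFun _ = true
      rw [character_compl, hσ]; rfl
    · refine Set.disjoint_left.2 fun τ h1 h2 => ?_
      change τ.toFun _ = true at h1 h2
      rw [character_compl, h1] at h2
      exact Bool.false_ne_true h2
  refine ⟨fun ρ σ hne => ?_⟩
  obtain ⟨e, he⟩ : ∃ e, ρ.toFun e ≠ σ.toFun e := by
    by_contra! h
    exact hne (LatticeCharacter.ext (funext h))
  cases h1 : ρ.toFun e with
  | true => exact key ρ σ e h1 (by simpa [h1] using he.symm)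
  | false =>
    obtain ⟨u, v, hu, hv, h3, h4, h5⟩ := key σ ρ e (by simpa [h1] using he.symm) h1
    exact ⟨v, u, hv, hu, h4, h3, h5.symm⟩

end Characters

/-- The spectrum of `D` is the character space of the lattice of idempotents of `S`. -/
def specHomeo : P.Spec ≃ₜ LatticeCharacter (Idem P.S) :=
  Continuous.homeoOfEquivCompactToT2
    (f := Equiv.ofBijective specToCharacter ⟨specToCharacter_injective, specToCharacter_surjective⟩)
    continuous_specToCharacter

end CartanPair

/-! ### Vector functionals and normal measures. -/

open MeasureTheory
open scoped CompactlySupported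

namespace CartanPair

open InverseMonoid

variable {H : Type u} [NormedAddCommGroup H] [InnerProductSpace ℂ H] [CompleteSpace H]
  {P : CartanPair H} {X : Type u} [TopologicalSpace X]

/-- The element of `D` defined by a continuous function on a copy of the spectrum. -/
def ofFun (h : P.Spec ≃ₜ X) (f : C(X, ℝ)) : H →L[ℂ] H :=
  P.ofSpec (f.comp ⟨h, h.continuous⟩)

variable (h : P.Spec ≃ₜ X)

theorem ofFun_mem (f : C(X, ℝ)) : ofFun h f ∈ P.D := (P.ofSpec _).2

theorem ofFun_eq {f : C(X, ℝ)} {a : P.D} (ha : ∀ φ : P.Spec, φ a = (f (h φ) : ℂ)) :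
    ofFun h f = a :=
  congrArg Subtype.val (spec_ext fun φ => by rw [spec_ofSpec, ha]; rfl)

theorem ofFun_add (f g : C(X, ℝ)) : ofFun h (f + g) = ofFun h f + ofFun h g :=
  ofFun_eq h (a := P.ofSpec _ + P.ofSpec _) fun φ => by simp

theorem ofFun_smul (c : ℝ) (f : C(X, ℝ)) : ofFun h (c • f) = (c : ℂ) • ofFun h f :=
  ofFun_eq h (a := (c : ℂ) • P.ofSpec _) fun φ => by
    rw [map_smul, spec_ofSpec]; simp

theorem ofFun_mul (f g : C(X, ℝ)) : ofFun h (f * g) = ofFun h f * ofFun h g :=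
  ofFun_eq h (a := P.ofSpec _ * P.ofSpec _) fun φ => by simp

theorem star_ofFun (f : C(X, ℝ)) : star (ofFun h f) = ofFun h f :=
  (ofFun_eq h (a := star (P.ofSpec _)) fun φ => by simp [map_star]).symm

theorem ofFun_eq_zero {f : C(X, ℝ)} (hf : ofFun h f = 0) : f = 0 := by
  ext x
  obtain ⟨φ, rfl⟩ := h.surjective x
  have h1 : P.ofSpec (f.comp ⟨h, h.continuous⟩) = 0 := Subtype.ext hf
  have h2 := congrArg φ h1
  rw [spec_ofSpec, map_zero] at h2
  exact_mod_cast h2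

theorem exists_ofFun_eq {T : H →L[ℂ] H} (hT : T ∈ P.D) (hs : star T = T) :
    ∃ f, ofFun h f = T := by
  let a : P.D := ⟨T, hT⟩
  have ha : star a = a := Subtype.ext hs
  refine ⟨⟨fun x => (h.symm x a).re, Complex.continuous_re.comp
    ((spec_continuous a).comp h.symm.continuous)⟩, ofFun_eq h (a := a) fun φ => ?_⟩
  have h1 : star (φ a) = φ a := by rw [← map_star, ha]
  simpa using (Complex.conj_eq_iff_re.1 h1).symm

theorem norm_ofFun_le {f : C(X, ℝ)} {C : ℝ} (hC : 0 ≤ C) (hf : ∀ x, |f x| ≤ C) :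
    ‖ofFun h f‖ ≤ C := by
  change ‖P.ofSpec _‖ ≤ C
  rw [← (gelfandTransform_isometry P.D).norm_map_of_map_zero (map_zero _),
    ContinuousMap.norm_le _ hC]
  intro φ
  change ‖φ (P.ofSpec _)‖ ≤ C
  rw [spec_ofSpec, Complex.norm_real]
  exact hf _

/-- The quadratic form at `ξ` of the element of `D` defined by a continuous function. -/
def quad (ξ : H) (f : C(X, ℝ)) : ℝ := (inner ℂ (ofFun h f ξ) ξ).re

theorem quad_add (ξ : H) (f g : C(X, ℝ)) : quad h ξ (f + g) = quad h ξ f + quad h ξ g := by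
  simp [quad, ofFun_add]

theorem quad_smul (ξ : H) (c : ℝ) (f : C(X, ℝ)) : quad h ξ (c • f) = c * quad h ξ f := by
  simp [quad, ofFun_smul]

theorem quad_sub (ξ : H) (f g : C(X, ℝ)) : quad h ξ (f - g) = quad h ξ f - quad h ξ g := by
  have := quad_add h ξ (f - g) g
  rw [sub_add_cancel] at this
  linarith

theorem quad_conj (ξ : H) (f m : C(X, ℝ)) :
    quad h (ofFun h m ξ) f = quad h ξ (m * f * m) := by
  rw [quad, quad, ofFun_mul, ofFun_mul, ← ContinuousLinearMap.adjoint_inner_left,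
    ← ContinuousLinearMap.star_eq_adjoint, star_ofFun]
  rfl

theorem quad_sq (ξ : H) (m : C(X, ℝ)) : quad h ξ (m * m) = ‖ofFun h m ξ‖ ^ 2 := by
  rw [quad, ofFun_mul]
  change (inner ℂ (ofFun h m (ofFun h m ξ)) ξ).re = _
  nth_rw 1 [← star_ofFun]
  rw [ContinuousLinearMap.star_eq_adjoint, ContinuousLinearMap.adjoint_inner_left]
  exact inner_self_eq_norm_sq (𝕜 := ℂ) _

theorem exists_sqrt {f : C(X, ℝ)} (hf : 0 ≤ f) : ∃ m : C(X, ℝ), m * m = f :=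
  ⟨⟨fun x => √(f x), by fun_prop⟩, ContinuousMap.ext fun x => Real.mul_self_sqrt (hf x)⟩

theorem quad_nonneg (ξ : H) {f : C(X, ℝ)} (hf : 0 ≤ f) : 0 ≤ quad h ξ f := by
  obtain ⟨m, rfl⟩ := exists_sqrt hf
  rw [quad_sq]
  positivity

theorem quad_mono (ξ : H) {f g : C(X, ℝ)} (hfg : f ≤ g) : quad h ξ f ≤ quad h ξ g := by
  have := quad_nonneg h ξ (sub_nonneg.2 hfg)
  rwa [quad_sub, sub_nonneg] at this

/-- With `f = m * m`, the quadratic form at `ξ` is the squared norm of the operator of `m` applied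
to `ξ`. -/
theorem eq_zero_of_quad {f : C(X, ℝ)} (hf : 0 ≤ f) (hq : ∀ ξ, quad h ξ f = 0) : f = 0 := by
  obtain ⟨m, rfl⟩ := exists_sqrt hf
  have : m = 0 := ofFun_eq_zero h (ContinuousLinearMap.ext fun ξ => by
    have := hq ξ
    rw [quad_sq] at this
    simpa using this)
  rw [this, zero_mul]

/-- For the negative part `n` of `f` one has `n f n = -n³`. Testing at the vectors `n ξ` makes the
form of `n³` nonpositive, so `n = 0`. -/
theorem nonneg_of_quad {f : C(X, ℝ)} (hq : ∀ ξ, 0 ≤ quad h ξ f) : 0 ≤ f := by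
  set n : C(X, ℝ) := -f ⊔ 0 with hn
  have hn0 : 0 ≤ n := le_sup_right
  have hnf : n * f * n = -(n * n * n) := by
    ext x
    rcases le_total (f x) 0 with hx | hx
    · have : n x = -f x := by simp [hn, hx]
      simp [this]
    · have : n x = 0 := by simp [hn, hx]
      simp [this]
  have hn3 : 0 ≤ n * n * n := fun x => mul_nonneg (mul_nonneg (hn0 x) (hn0 x)) (hn0 x)
  have h1 := eq_zero_of_quad h hn3 fun ξ => le_antisymm (by
    have h2 := hq (ofFun h n ξ)
    rw [quad_conj, hnf, ← neg_one_smul ℝ, quad_smul] at h2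
    linarith) (quad_nonneg h ξ hn3)
  intro x
  have h2 : n x * n x * n x = 0 := congrArg (fun g : C(X, ℝ) => g x) h1
  have h3 : n x = 0 := by simpa using h2
  have h4 : -f x ≤ n x := le_sup_left (a := -f x) (b := 0)
  change 0 ≤ f x
  linarith

/-- Vector functionals preserve suprema of bounded directed sets. -/
theorem isLUB_quad [CompactSpace X] (ξ : H) {F : Set C(X, ℝ)} {f : C(X, ℝ)} (hne : F.Nonempty)
    (hdir : DirectedOn (· ≤ ·) F) (hf : IsLUB F f) :
    IsLUB (quad h ξ '' F) (quad h ξ f) := by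
  refine ⟨?_, fun b hb => ?_⟩
  · rintro _ ⟨g, hg, rfl⟩
    exact quad_mono h ξ (hf.1 hg)
  have : Nonempty F := hne.to_subtype
  have : IsDirectedOrder F := ⟨fun a b => by
    obtain ⟨c, hc, hac, hbc⟩ := hdir a a.2 b b.2
    exact ⟨⟨c, hc⟩, hac, hbc⟩⟩
  let U : Ultrafilter F := Ultrafilter.of atTop
  have hU : (U : Filter F) ≤ atTop := Ultrafilter.of_le _
  obtain ⟨g₀, hg₀⟩ := hne
  -- Beyond a fixed member `g₀`, the family lies between `g₀` and `f`, which bounds it in norm.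
  obtain ⟨T, hT⟩ := exists_weak_limit U (fun g : F => ofFun h g.1) (max ‖g₀‖ ‖f‖) (by
    refine hU ((eventually_ge_atTop (⟨g₀, hg₀⟩ : F)).mono fun g hg => ?_)
    refine norm_ofFun_le h (le_max_of_le_left (norm_nonneg _)) fun x => abs_le.2 ⟨?_, ?_⟩
    · have h1 : g₀ x ≤ g.1 x := hg x
      have h2 := neg_le_of_abs_le (g₀.norm_coe_le_norm x)
      linarith [le_max_left ‖g₀‖ ‖f‖]
    · have h1 : g.1 x ≤ f x := hf.1 g.2 x
      have h2 := le_of_abs_le (f.norm_coe_le_norm x)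
      linarith [le_max_right ‖g₀‖ ‖f‖])
  have hTs : star T = T := hT.star.unique
    (hT.congr (Eventually.of_forall fun g => (star_ofFun h g.1).symm))
  obtain ⟨k, rfl⟩ := exists_ofFun_eq h
    (P.mem_D_of_tendstoWeakly hT fun g => ofFun_mem h g.1) hTs
  have hlim : ∀ η, Tendsto (fun g : F => quad h η g.1) U (𝓝 (quad h η k)) := fun η =>
    (Complex.continuous_re.tendsto _).comp (hT η η)
  -- The weak limit is an element `k` of `D` that bounds `F`, so `f ≤ k`; this compares the form of
  -- `f` with a limit of forms on `F`.
  have hk : ∀ g ∈ F, g ≤ k := fun g hg => sub_nonneg.1 <| nonneg_of_quad h fun η => by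
    rw [quad_sub, sub_nonneg]
    exact ge_of_tendsto (hlim η) (hU ((eventually_ge_atTop (⟨g, hg⟩ : F)).mono fun g' hg' =>
      quad_mono h η hg'))
  exact (quad_mono h ξ (hf.2 hk)).trans
    (le_of_tendsto (hlim ξ) (Eventually.of_forall fun g => hb ⟨g.1, g.2, rfl⟩))

/-- Riesz representation of the positive functional `quad h ξ`; on the compact space `X` every
continuous function has compact support. -/
theorem exists_measure_quad [CompactSpace X] [T2Space X] [MeasurableSpace X] [BorelSpace X]
    (ξ : H) : ∃ μ : Measure X, IsFiniteMeasure μ ∧ μ.Regular ∧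
      ∀ f : C(X, ℝ), ∫ x, f x ∂μ = quad h ξ f := by
  let Λ : C_c(X, ℝ) →ₚ[ℝ] ℝ := PositiveLinearMap.mk₀
    { toFun := fun f => quad h ξ f.toContinuousMap
      map_add' := fun f g => quad_add h ξ _ _
      map_smul' := fun c f => quad_smul h ξ c _ }
    fun f hf => quad_nonneg h ξ hf
  exact ⟨RealRMK.rieszMeasure Λ, inferInstance, inferInstance, fun f =>
    RealRMK.integral_rieszMeasure Λ (CompactlySupportedContinuousMap.continuousMapEquiv f)⟩

theorem exists_isNormalMeasure [CompactSpace X] [T2Space X] [MeasurableSpace X] [BorelSpace X]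
    (h : P.Spec ≃ₜ X) {f : C(X, ℝ)} (hf : 0 ≤ f) (hf0 : f ≠ 0) :
    ∃ μ : Measure X, IsNormalMeasure μ ∧ 0 < ∫ x, f x ∂μ := by
  obtain ⟨ξ, hξ⟩ : ∃ ξ, quad h ξ f ≠ 0 := by
    by_contra! hq
    exact hf0 (eq_zero_of_quad h hf hq)
  obtain ⟨μ, h1, h2, h3⟩ := exists_measure_quad h ξ
  refine ⟨μ, ⟨h1, h2, fun F g hne hdir hg => ?_⟩, ?_⟩
  · simp only [h3]
    exact isLUB_quad h ξ hne hdir hg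
  · rw [h3]
    exact (quad_nonneg h ξ hf).lt_of_ne' hξ

theorem isHyperstonean_character (P : CartanPair H) :
    IsHyperstonean (LatticeCharacter (Idem P.S)) where
  compact := P.specHomeo.compactSpace
  t2 := inferInstance
  extremallyDisconnected := extremallyDisconnected_of_homeo P.specHomeo
  exists_normal := by
    let _ : MeasurableSpace (LatticeCharacter (Idem P.S)) := borel _
    have : BorelSpace (LatticeCharacter (Idem P.S)) := ⟨rfl⟩
    have : CompactSpace (LatticeCharacter (Idem P.S)) := P.specHomeo.compactSpace
    exact fun f hf hf0 => exists_isNormalMeasure P.specHomeo hf hf0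

end CartanPair

end

theorem proposition3p5 {H : Type u} [NormedAddCommGroup H] [InnerProductSpace ℂ H]
    [CompleteSpace H] (P : CartanPair H) : InverseMonoid.IsCartan P.S :=
  ⟨P.fundamental_S, P.isCompleteBoolean_S, CartanPair.isHyperstonean_character P⟩
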